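/- Let $\mathbb K=\mathbb C(\mathsf u,\mathsf v)$ be the field of rational functions in two indeterminates; algebras are unital associative $\mathbb K$-algebras. Let $n\ge 1$ and $d\ge 1$, and let $s_i$ denote the transposition $(i,i+1)$. Let $\mathrm Y_{d,n}^{\mathtt B}$ be the algebra generated by $t_1,\dots,t_n$, $g_1,\dots,g_{n-1}$, $b_1$, subject to the relations \begin{align*} & g_ig_j=g_jg_i\ (|i-j|>1),\quad g_ig_jg_i=g_jg_ig_j\ (|i-j|=1),\quad b_1g_i=g_ib_1\ (i\neq 1),\quad b_1g_1b_1g_1=g_1b_1g_1b_1,\\ & t_it_j=t_jt_i,\quad t_jg_i=g_it_{s_i(j)},\quad t_ib_1=b_1t_i,\quad t_i^d=1,\\ & g_i^2=1+(\mathsf u-\mathsf u^{-1})e_ig_i,\quad b_1^2=1+(\mathsf v-\mathsf v^{-1})f_1b_1, \end{align*} for all admissible indices, where $e_i=\frac1d\sum_{s=0}^{d-1}t_i^st_{i+1}^{d-s}$ for $1\le i\le n-1$ and $f_j=\frac1d\sum_{s=0}^{d-1}t_j^s$ for $1\le j\le n$. Let $\mathcal E_n^{\mathtt B}$ be the algebra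 generated by $B_1$, $T_1,\dots,T_{n-1}$, $F_1,\dots,F_n$, $E_1,\dots,E_{n-1}$, subject to the relations \begin{align*} & T_iT_j=T_jT_i\ (|i-j|>1),\quad T_iT_{i+1}T_i=T_{i+1}T_iT_{i+1},\quad T_i^2=1+(\mathsf u-\mathsf u^{-1})E_iT_i,\\ & E_i^2=E_i,\quad E_iE_j=E_jE_i,\quad E_iT_i=T_iE_i,\quad E_iT_j=T_jE_i\ (|i-j|>1),\\ & E_iE_jT_i=T_iE_iE_j=E_jT_iE_j\ \text{ and }\ E_iT_jT_i=T_jT_iE_j\ (|i-j|=1),\\ & B_1T_1B_1T_1=T_1B_1T_1B_1,\quad B_1T_i=T_iB_1\ (i>1),\quad B_1^2=1+(\mathsf v-\mathsf v^{-1})F_1B_1,\quad B_1E_i=E_iB_1,\\ & F_i^2=F_i,\quad B_1F_j=F_jB_1,\quad F_iE_j=E_jF_i,\quad F_jT_i=T_iF_{s_i(j)},\quad E_iF_i=F_iF_{i+1}=E_iF_{i+1}, \end{align*} for all admissible indices. (For $n=1$ only the generators $t_1,b_1$, respectively $B_1,F_1$, and the relations among them occur.) Suppose that $d\ge n+1$.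 Then there is a unique algebra homomorphism $\varphi_n:\mathcal E_n^{\mathtt B}\to\mathrm Y_{d,n}^{\mathtt B}$ with $T_i\mapsto g_i$, $E_i\mapsto e_i$ $(1\le i\le n-1)$, $F_j\mapsto f_j$ $(1\le j\le n)$ and $B_1\mapsto b_1$, and $\varphi_n$ is injective. -/

import Mathlib

namespace BraidsTiesB

noncomputable section

/-- The base field `ℂ(u, v)` of rational functions in two indeterminates. -/
abbrev K : Type := FractionRing (MvPolynomial (Fin 2) ℂ)

/-- The indeterminate `u`. -/
def u : K := algebraMap (MvPolynomial (Fin 2) ℂ) K (MvPolynomial.X 0)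

/-- The indeterminate `v`. -/
def v : K := algebraMap (MvPolynomial (Fin 2) ℂ) K (MvPolynomial.X 1)

/-! All indices below start at `0`: the index `i : Fin (n - 1)` stands for the mathematical
index `i + 1 ∈ {1, …, n - 1}`, and `j : Fin n` stands for `j + 1 ∈ {1, …, n}`. -/

/-- The position `i` in `{1, …, n}`, for `i` in `{1, …, n - 1}`. -/
def lo {n : ℕ} (i : Fin (n - 1)) : Fin n := ⟨i.val, by omega⟩

/-- The position `i + 1` in `{1, …, n}`, for `i` in `{1, …, n - 1}`. -/
def hi {n : ℕ} (i : Fin (n - 1)) : Fin n := ⟨i.val + 1, by omega⟩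

/-- The transposition `s_i = (i, i + 1)` of `{1, …, n}`. -/
def s {n : ℕ} (i : Fin (n - 1)) : Equiv.Perm (Fin n) := Equiv.swap (lo i) (hi i)

/-- `|i - j| > 1`. -/
def Far {m : ℕ} (i j : Fin m) : Prop := i.val + 1 < j.val ∨ j.val + 1 < i.val

/-- `|i - j| = 1`. -/
def Near {m : ℕ} (i j : Fin m) : Prop := i.val + 1 = j.val ∨ j.val + 1 = i.val

/-! ### The framization of the Hecke algebra of type B -/

/-- The generators of `Y_{d,n}^B`: framing generators `t_1, …, t_n`, braiding generators
`g_1, …, g_{n-1}` and the loop generator `b_1`. -/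
inductive YGen (n : ℕ) : Type
  | t (j : Fin n)
  | g (i : Fin (n - 1))
  | b

namespace YFree

/-- The free algebra on the generators of `Y_{d,n}^B`. -/
abbrev Alg (n : ℕ) : Type := FreeAlgebra K (YGen n)

def t {n : ℕ} (j : Fin n) : Alg n := FreeAlgebra.ι K (YGen.t j)

def g {n : ℕ} (i : Fin (n - 1)) : Alg n := FreeAlgebra.ι K (YGen.g i)

def b {n : ℕ} : Alg n := FreeAlgebra.ι K YGen.b

/-- `e_i = (1/d) ∑_{s=0}^{d-1} t_i^s t_{i+1}^{d-s}`. -/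
def e (d : ℕ) {n : ℕ} (i : Fin (n - 1)) : Alg n :=
  (d : K)⁻¹ • ∑ k ∈ Finset.range d, t (lo i) ^ k * t (hi i) ^ (d - k)

/-- `f_j = (1/d) ∑_{s=0}^{d-1} t_j^s`. -/
def f (d : ℕ) {n : ℕ} (j : Fin n) : Alg n :=
  (d : K)⁻¹ • ∑ k ∈ Finset.range d, t j ^ k

end YFree

open YFree in
/-- The defining relations of `Y_{d,n}^B`. -/
inductive YRel (d n : ℕ) [NeZero n] : YFree.Alg n → YFree.Alg n → Prop
  | g_far (i j : Fin (n - 1)) (h : Far i j) : YRel d n (g i * g j) (g j * g i)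
  | g_braid (i j : Fin (n - 1)) (h : Near i j) : YRel d n (g i * g j * g i) (g j * g i * g j)
  | b_g (i : Fin (n - 1)) (h : i.val ≠ 0) : YRel d n (b * g i) (g i * b)
  | b_braid (i : Fin (n - 1)) (h : i.val = 0) :
      YRel d n (b * g i * b * g i) (g i * b * g i * b)
  | t_t (i j : Fin n) : YRel d n (t i * t j) (t j * t i)
  | t_g (j : Fin n) (i : Fin (n - 1)) : YRel d n (t j * g i) (g i * t (s i j))
  | t_b (i : Fin n) : YRel d n (t i * b) (b * t i)
  | t_pow (i : Fin n) : YRel d n (t i ^ d) 1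
  | g_sq (i : Fin (n - 1)) : YRel d n (g i ^ 2) (1 + (u - u⁻¹) • (e d i * g i))
  | b_sq : YRel d n (b ^ 2) (1 + (v - v⁻¹) • (f d 0 * b))

/-- The framization `Y_{d,n}^B` of the Hecke algebra of type B. -/
abbrev YB (d n : ℕ) [NeZero n] : Type := RingQuot (YRel d n)

namespace YB

variable (d n : ℕ) [NeZero n]

/-- The quotient map from the free algebra. -/
def mk : YFree.Alg n →ₐ[K] YB d n := RingQuot.mkAlgHom K (YRel d n)

variable {n}

def t (j : Fin n) : YB d n := mk d n (YFree.t j)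

def g (i : Fin (n - 1)) : YB d n := mk d n (YFree.g i)

/-- `e_i = (1/d) ∑_{s=0}^{d-1} t_i^s t_{i+1}^{d-s}` in `Y_{d,n}^B`. -/
def e (i : Fin (n - 1)) : YB d n :=
  (d : K)⁻¹ • ∑ k ∈ Finset.range d, t d (lo i) ^ k * t d (hi i) ^ (d - k)

/-- `f_j = (1/d) ∑_{s=0}^{d-1} t_j^s` in `Y_{d,n}^B`. -/
def f (j : Fin n) : YB d n := (d : K)⁻¹ • ∑ k ∈ Finset.range d, t d j ^ k

variable (n)

def b : YB d n := mk d n YFree.b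

end YB

/-! ### The algebra of braids and ties of type B -/

/-- The generators `B_1`, `T_1, …, T_{n-1}`, `F_1, …, F_n`, `E_1, …, E_{n-1}` of `E_n^B`. -/
inductive BTGen (n : ℕ) : Type
  | B
  | T (i : Fin (n - 1))
  | F (j : Fin n)
  | E (i : Fin (n - 1))

namespace BTFree

/-- The free algebra on the generators of `E_n^B`. -/
abbrev Alg (n : ℕ) : Type := FreeAlgebra K (BTGen n)

def B {n : ℕ} : Alg n := FreeAlgebra.ι K BTGen.B

def T {n : ℕ} (i : Fin (n - 1)) : Alg n := FreeAlgebra.ι K (BTGen.T i)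

def F {n : ℕ} (j : Fin n) : Alg n := FreeAlgebra.ι K (BTGen.F j)

def E {n : ℕ} (i : Fin (n - 1)) : Alg n := FreeAlgebra.ι K (BTGen.E i)

end BTFree

open BTFree in
/-- The defining relations of `E_n^B`. -/
inductive BTRel (n : ℕ) [NeZero n] : BTFree.Alg n → BTFree.Alg n → Prop
  | T_far (i j : Fin (n - 1)) (h : Far i j) : BTRel n (T i * T j) (T j * T i)
  | T_braid (i j : Fin (n - 1)) (h : i.val + 1 = j.val) :
      BTRel n (T i * T j * T i) (T j * T i * T j)
  | T_sq (i : Fin (n - 1)) : BTRel n (T i ^ 2) (1 + (u - u⁻¹) • (E i * T i))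
  | E_sq (i : Fin (n - 1)) : BTRel n (E i ^ 2) (E i)
  | E_E (i j : Fin (n - 1)) : BTRel n (E i * E j) (E j * E i)
  | E_T (i : Fin (n - 1)) : BTRel n (E i * T i) (T i * E i)
  | E_T_far (i j : Fin (n - 1)) (h : Far i j) : BTRel n (E i * T j) (T j * E i)
  | E_E_T (i j : Fin (n - 1)) (h : Near i j) : BTRel n (E i * E j * T i) (T i * E i * E j)
  | T_E_E (i j : Fin (n - 1)) (h : Near i j) : BTRel n (T i * E i * E j) (E j * T i * E j)
  | E_T_T (i j : Fin (n - 1)) (h : Near i j) : BTRel n (E i * T j * T i) (T j * T i * E j)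
  | B_braid (i : Fin (n - 1)) (h : i.val = 0) :
      BTRel n (B * T i * B * T i) (T i * B * T i * B)
  | B_T (i : Fin (n - 1)) (h : i.val ≠ 0) : BTRel n (B * T i) (T i * B)
  | B_sq : BTRel n (B ^ 2) (1 + (v - v⁻¹) • (F 0 * B))
  | B_E (i : Fin (n - 1)) : BTRel n (B * E i) (E i * B)
  | F_sq (j : Fin n) : BTRel n (F j ^ 2) (F j)
  | B_F (j : Fin n) : BTRel n (B * F j) (F j * B)
  | F_E (j : Fin n) (i : Fin (n - 1)) : BTRel n (F j * E i) (E i * F j)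
  | F_T (j : Fin n) (i : Fin (n - 1)) : BTRel n (F j * T i) (T i * F (s i j))
  | E_F_lo (i : Fin (n - 1)) : BTRel n (E i * F (lo i)) (F (lo i) * F (hi i))
  | E_F_hi (i : Fin (n - 1)) : BTRel n (F (lo i) * F (hi i)) (E i * F (hi i))

/-- The algebra `E_n^B` of braids and ties of type B. -/
abbrev BT (n : ℕ) [NeZero n] : Type := RingQuot (BTRel n)

namespace BT

variable (n : ℕ) [NeZero n]

/-- The quotient map from the free algebra. -/
def mk : BTFree.Alg n →ₐ[K] BT n := RingQuot.mkAlgHom K (BTRel n)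

def B : BT n := mk n BTFree.B

variable {n}

def T (i : Fin (n - 1)) : BT n := mk n (BTFree.T i)

def F (j : Fin n) : BT n := mk n (BTFree.F j)

def E (i : Fin (n - 1)) : BT n := mk n (BTFree.E i)

end BT

/-- The homomorphism `E_n^B → Y_{d,n}^B` is the natural one:
`T_i ↦ g_i`, `E_i ↦ e_i`, `F_i ↦ f_i`, `B_1 ↦ b_1`. -/
def IsNatural {d n : ℕ} [NeZero n] (φ : BT n →ₐ[K] YB d n) : Prop :=
  (∀ i : Fin (n - 1), φ (BT.T i) = YB.g d i) ∧
  (∀ i : Fin (n - 1), φ (BT.E i) = YB.e d i) ∧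
  (∀ j : Fin n, φ (BT.F j) = YB.f d j) ∧
  φ (BT.B n) = YB.b d n

end

end BraidsTiesB

/-! Existence of the homomorphism is a computation with averages. For commuting `a`, `b` with `a ^ d
= b ^ d = 1`, `avg k d a b` is the idempotent projecting onto the part where `a` and `b` agree. Both
`e_i` (the average of two framing generators) and `f_j` (the average of `t_j` and `1`) are of this
kind, so the relations on ties express that equality is an equivalence relation and that the `g_i`
permute the `t_j`.

Injectivity compares a spanning set of the source with representations of the target. Add a position
`0` and let `F_j` tie `j` to `0`. Conjugating the generators `E_i`, `F_j` yields a tie (`bond`) for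
each pair in `{0, …, n}`. Ties are commuting idempotents, satisfy transitivity (`bond_mul_bond`),
are permuted by the `T_i` and commute with `B_1`. Hence every element of the source is a sum `∑
p_a(ties) · T_a` over signed permutations `a`, with polynomial coefficients (`standard_surjective`).

In the other direction, colour the letters `1, …, n` by `d`-th roots of unity, with `0` coloured
`1`. The framization then acts on the span of signed permutations: `t_j` multiplies by the colour of
the `j`-th letter, `g_i` exchanges adjacent letters and `b_1` changes the first sign, each with a
Hecke correction at descents whose colours agree. Applied to the identity word, `T_a` gives exactly
the word `a`, so the coordinate at `a` of the whole sum is `p_a` evaluated at the 0/1 matrix of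
equalities of colours (`action_standard`).

If the image of the sum is zero, each `p_a` vanishes at every such matrix. Transitivity forces a
nonzero joint eigenspace of the ties to come from an equivalence relation on `n + 1` points, and
since `d ≥ n + 1` every such relation comes from a colouring. So `p_a(ties) = 0` for every `a`
(`tiePoly_eq_zero`). No basis or dimension of either algebra is needed. -/

namespace BraidsTiesB

noncomputable section

/-! ### Averages of commuting elements of finite order -/

section Avg

variable (k : Type*) {A : Type*} [Field k] [Ring A] [Algebra k A]

/-- The average `(1/d) ∑_{s=0}^{d-1} a^s b^{d-s}`. -/
def avg (d : ℕ) (a b : A) : A := (d : k)⁻¹ • ∑ i ∈ Finset.range d, a ^ i * b ^ (d - i)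

variable {k} {d : ℕ} {a b c : A}

/-- The terms of index `0` and `d` are both `1`, so the summation range can be shifted by one.
Symmetry and `a · avg = avg · b` both come from this shift. -/
theorem avg_eq_sum_succ (ha : a ^ d = 1) (hb : b ^ d = 1) :
    avg k d a b = (d : k)⁻¹ • ∑ i ∈ Finset.range d, a ^ (i + 1) * b ^ (d - (i + 1)) := by
  have h := (Finset.sum_range_succ (fun i => a ^ i * b ^ (d - i)) d).symm.trans
    (Finset.sum_range_succ' (fun i => a ^ i * b ^ (d - i)) d)
  simp only [Nat.sub_self, pow_zero, mul_one, Nat.sub_zero, ha, hb, add_left_inj] at h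
  rw [avg, h]

theorem avg_comm (hab : Commute a b) (ha : a ^ d = 1) (hb : b ^ d = 1) :
    avg k d a b = avg k d b a := by
  rw [avg_eq_sum_succ ha hb, avg, ← Finset.sum_range_reflect]
  congr 1
  refine Finset.sum_congr rfl fun i hi => ?_
  have hi := Finset.mem_range.1 hi
  rw [(hab.pow_pow _ _).eq]
  congr 2 <;> omega

theorem mul_avg (ha : a ^ d = 1) (hb : b ^ d = 1) :
    a * avg k d a b = avg k d a b * b := by
  conv_rhs => rw [avg_eq_sum_succ ha hb]
  rw [avg, mul_smul_comm, smul_mul_assoc, Finset.mul_sum, Finset.sum_mul]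
  congr 1
  refine Finset.sum_congr rfl fun i hi => ?_
  have hi := Finset.mem_range.1 hi
  rw [← mul_assoc, ← pow_succ', mul_assoc, ← pow_succ]
  congr 2
  omega

theorem semiconjBy_avg {g a' b' : A} (ha : SemiconjBy g a a') (hb : SemiconjBy g b b') :
    SemiconjBy g (avg k d a b) (avg k d a' b') := by
  simp only [SemiconjBy, BraidsTiesB.avg, mul_smul_comm, smul_mul_assoc, Finset.mul_sum,
    Finset.sum_mul]
  congr 1
  exact Finset.sum_congr rfl fun i _ => (ha.pow_right i).mul_right (hb.pow_right _)

theorem avg_mul_pow (hab : Commute a b) (ha : a ^ d = 1) (hb : b ^ d = 1) (m : ℕ) :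
    avg k d a b * a ^ m = avg k d a b * b ^ m := by
  induction m with
  | zero => simp
  | succ m ih =>
    have h : Commute a (avg k d a b) := semiconjBy_avg (Commute.refl a) hab
    rw [pow_succ', ← mul_assoc, ← h.eq, mul_avg ha hb, mul_assoc, (hab.symm.pow_right m).eq,
      ← mul_assoc, ih, mul_assoc, ← pow_succ]

/-- Multiplying by the average of `a` and `b` makes powers of `a` and `b` interchangeable. This is
the source of all transitivity relations among the `e_i` and `f_j`. -/
theorem avg_mul_avg (hab : Commute a b) (ha : a ^ d = 1) (hb : b ^ d = 1) :
    avg k d a b * avg k d b c = avg k d a b * avg k d a c := by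
  simp only [avg.eq_1 k d b c, avg.eq_1 k d a c, mul_smul_comm, Finset.mul_sum, ← mul_assoc,
    avg_mul_pow hab ha hb]

theorem avg_self (hd : (d : k) ≠ 0) (ha : a ^ d = 1) : avg k d a a = 1 := by
  have h : ∀ i ∈ Finset.range d, a ^ i * a ^ (d - i) = 1 := fun i hi => by
    rw [← pow_add, Nat.add_sub_cancel' (Finset.mem_range.1 hi).le, ha]
  rw [avg, Finset.sum_congr rfl h, Finset.sum_const, Finset.card_range,
    ← Nat.cast_smul_eq_nsmul k, smul_smul, inv_mul_cancel₀ hd, one_smul]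

theorem avg_mul_self (hd : (d : k) ≠ 0) (hab : Commute a b) (ha : a ^ d = 1) (hb : b ^ d = 1) :
    avg k d a b * avg k d a b = avg k d a b := by
  rw [← avg_mul_avg hab ha hb, avg_self hd hb, mul_one]

theorem avg_one_right : avg k d a 1 = (d : k)⁻¹ • ∑ i ∈ Finset.range d, a ^ i := by
  simp [avg]

end Avg

/-! ### Positions -/

section Positions

variable {n : ℕ}

theorem lo_ne_hi (i : Fin (n - 1)) : lo i ≠ hi i := by simp [lo, hi, Fin.ext_iff]

@[simp] theorem s_lo (i : Fin (n - 1)) : s i (lo i) = hi i := Equiv.swap_apply_left _ _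

@[simp] theorem s_hi (i : Fin (n - 1)) : s i (hi i) = lo i := Equiv.swap_apply_right _ _

theorem s_of_ne {i : Fin (n - 1)} {j : Fin n} (h₁ : j ≠ lo i) (h₂ : j ≠ hi i) : s i j = j :=
  Equiv.swap_apply_of_ne_of_ne h₁ h₂

@[simp] theorem s_s (i : Fin (n - 1)) (j : Fin n) : s i (s i j) = j := Equiv.swap_apply_self _ _ _

theorem hi_eq_lo {i j : Fin (n - 1)} (h : i.val + 1 = j.val) : hi i = lo j := Fin.ext h

end Positions

/-! ### Relations in the framization, and the natural homomorphism -/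

namespace YB

variable {d n : ℕ} [NeZero n]

theorem mk_rel {x y : YFree.Alg n} (h : YRel d n x y) : mk d n x = mk d n y :=
  RingQuot.mkAlgHom_rel K h

theorem mk_e (i : Fin (n - 1)) : mk d n (YFree.e d i) = e d i := by
  simp [YFree.e, e, t]

theorem mk_f (i : Fin n) : mk d n (YFree.f d i) = f d i := by
  simp [YFree.f, f, t]

theorem f_eq (j : Fin n) : f d j = avg K d (t d j) 1 :=
  (avg_one_right (k := K) (d := d) (a := t d j)).symm

theorem g_far {i j : Fin (n - 1)} (h : Far i j) : g d i * g d j = g d j * g d i := by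
  simpa [g] using mk_rel (d := d) (YRel.g_far i j h)

theorem g_braid {i j : Fin (n - 1)} (h : Near i j) :
    g d i * g d j * g d i = g d j * g d i * g d j := by
  simpa [g] using mk_rel (d := d) (YRel.g_braid i j h)

theorem b_g {i : Fin (n - 1)} (h : i.val ≠ 0) : b d n * g d i = g d i * b d n := by
  simpa [g, b] using mk_rel (d := d) (YRel.b_g i h)

theorem b_braid {i : Fin (n - 1)} (h : i.val = 0) :
    b d n * g d i * b d n * g d i = g d i * b d n * g d i * b d n := by
  simpa [g, b] using mk_rel (d := d) (YRel.b_braid i h)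

theorem t_t (i j : Fin n) : Commute (t d i) (t d j) := by
  have h := mk_rel (d := d) (YRel.t_t i j)
  rwa [map_mul, map_mul] at h

theorem g_t (i : Fin (n - 1)) (j : Fin n) : SemiconjBy (g d i) (t d j) (t d (s i j)) := by
  have h := mk_rel (d := d) (YRel.t_g (s i j) i)
  rw [s_s, map_mul, map_mul] at h
  exact h.symm

theorem b_t (j : Fin n) : Commute (b d n) (t d j) := by
  have h := mk_rel (d := d) (YRel.t_b j)
  rw [map_mul, map_mul] at h
  exact h.symm

theorem t_pow (j : Fin n) : t d j ^ d = 1 := by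
  simpa [t] using mk_rel (d := d) (YRel.t_pow j)

theorem g_sq (i : Fin (n - 1)) : g d i ^ 2 = 1 + (u - u⁻¹) • (e d i * g d i) := by
  have h := mk_rel (d := d) (YRel.g_sq i)
  rwa [map_pow, map_add, map_one, map_smul, map_mul, mk_e] at h

theorem b_sq : b d n ^ 2 = 1 + (v - v⁻¹) • (f d 0 * b d n) := by
  have h := mk_rel (YRel.b_sq (d := d) (n := n))
  rwa [map_pow, map_add, map_one, map_smul, map_mul, mk_f] at h

variable (d) in
/-- The average of `t_i` and `t_j`. -/
def ee (i j : Fin n) : YB d n := avg K d (t d i) (t d j)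

theorem ee_comm (i j : Fin n) : ee d i j = ee d j i := avg_comm (t_t i j) (t_pow i) (t_pow j)

theorem ee_mul_ee (i j l : Fin n) : ee d i j * ee d j l = ee d i j * ee d i l :=
  avg_mul_avg (t_t i j) (t_pow i) (t_pow j)

theorem commute_t_ee (i j l : Fin n) : Commute (t d i) (ee d j l) :=
  semiconjBy_avg (t_t i j) (t_t i l)

theorem ee_commute (i j l m : Fin n) : Commute (ee d i j) (ee d l m) :=
  semiconjBy_avg (commute_t_ee l i j).symm (commute_t_ee m i j).symm

theorem g_ee (i : Fin (n - 1)) (j l : Fin n) :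
    SemiconjBy (g d i) (ee d j l) (ee d (s i j) (s i l)) :=
  semiconjBy_avg (g_t i j) (g_t i l)

theorem b_ee (j l : Fin n) : Commute (b d n) (ee d j l) := semiconjBy_avg (b_t j) (b_t l)

theorem commute_t_f (i j : Fin n) : Commute (t d i) (f d j) := by
  rw [f_eq]
  exact semiconjBy_avg (t_t i j) (Commute.one_right _)

theorem f_ee (i j l : Fin n) : Commute (f d i) (ee d j l) :=
  semiconjBy_avg (commute_t_f j i).symm (commute_t_f l i).symm

theorem b_f (j : Fin n) : Commute (b d n) (f d j) := by
  rw [f_eq]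
  exact semiconjBy_avg (b_t j) (Commute.one_right _)

theorem g_f (i : Fin (n - 1)) (j : Fin n) : SemiconjBy (g d i) (f d j) (f d (s i j)) := by
  rw [f_eq, f_eq]
  exact semiconjBy_avg (g_t i j) (SemiconjBy.one_right _)

theorem ee_mul_f (i j : Fin n) : ee d i j * f d j = ee d i j * f d i := by
  rw [f_eq, f_eq]
  exact avg_mul_avg (t_t i j) (t_pow i) (t_pow j)

/-- Transitivity of equality through the middle element `1`. -/
theorem f_mul_f (i j : Fin n) : f d i * f d j = f d i * ee d i j := by
  have h := avg_mul_avg (k := K) (c := t d j) (Commute.one_right (t d i)) (t_pow i) (one_pow d)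
  rwa [avg_comm (Commute.one_left _) (one_pow d) (t_pow j), ← f_eq, ← f_eq] at h

theorem ee_mul_self (hd : (d : K) ≠ 0) (i j : Fin n) : ee d i j * ee d i j = ee d i j :=
  avg_mul_self hd (t_t i j) (t_pow i) (t_pow j)

theorem f_mul_self (hd : (d : K) ≠ 0) (j : Fin n) : f d j * f d j = f d j := by
  rw [f_eq]
  exact avg_mul_self hd (Commute.one_right _) (t_pow j) (one_pow d)

/-- Treats `j = i + 1` and `j = i - 1` together: `b` is the position shared by the two
transpositions, `a` and `c` are the outer ones. -/
theorem exists_near {i j : Fin (n - 1)} (h : Near i j) : ∃ a b c : Fin n,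
    e d i = ee d a b ∧ e d j = ee d b c ∧ s i a = b ∧ s i b = a ∧ s i c = c ∧ s j a = a ∧
      s j b = c ∧ s j c = b := by
  rcases h with h | h
  · have hb := hi_eq_lo h
    refine ⟨lo i, hi i, hi j, rfl, by rw [hb]; rfl, s_lo i, s_hi i, ?_, ?_, by rw [hb, s_lo],
      by rw [hb, s_hi]⟩ <;> apply s_of_ne <;> simp only [ne_eq, Fin.ext_iff, lo, hi] <;> omega
  · have hb := hi_eq_lo h
    refine ⟨hi i, lo i, lo j, ee_comm _ _, by rw [← hb]; exact ee_comm _ _, s_hi i, s_lo i, ?_, ?_,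
      by rw [← hb, s_hi], by rw [← hb, s_lo]⟩ <;> apply s_of_ne <;>
      simp only [ne_eq, Fin.ext_iff, lo, hi] <;> omega

theorem e_e_g {i j : Fin (n - 1)} (h : Near i j) :
    e d i * e d j * g d i = g d i * e d i * e d j := by
  obtain ⟨a, b, c, hi, hj, ha, hb, hc, -⟩ := exists_near (d := d) h
  have h1 := (g_ee (d := d) i a b).mul_right (g_ee i b c)
  rw [ha, hb, hc, ee_comm b a, ← ee_mul_ee, ← hi, ← hj] at h1
  rw [← h1.eq, mul_assoc]

theorem g_e_e {i j : Fin (n - 1)} (h : Near i j) :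
    g d i * e d i * e d j = e d j * g d i * e d j := by
  obtain ⟨a, b, c, hi, hj, ha, hb, hc, -⟩ := exists_near (d := d) h
  have h1 := (g_ee (d := d) i a c).eq
  rw [ha, hc] at h1
  rw [hi, hj, ← h1, mul_assoc, mul_assoc, (ee_commute a c b c).eq, ee_comm b c, ee_comm a c,
    ← ee_mul_ee, (ee_commute c b b a).eq, ee_comm b a, ee_comm c b]

theorem e_g_g {i j : Fin (n - 1)} (h : Near i j) :
    e d i * g d j * g d i = g d j * g d i * e d j := by
  obtain ⟨a, b, c, hi, hj, ha, hb, hc, ha', hb', hc'⟩ := exists_near (d := d) h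
  have h1 := (g_ee (d := d) i b c)
  have h2 := (g_ee (d := d) j a c)
  rw [hb, hc] at h1
  rw [ha', hc'] at h2
  rw [hi, hj, (h2.mul_left h1).eq, mul_assoc]

theorem e_g {i : Fin (n - 1)} : e d i * g d i = g d i * e d i := by
  have h1 := g_ee (d := d) i (lo i) (hi i)
  rw [s_lo, s_hi, ee_comm (hi i)] at h1
  exact h1.eq.symm

theorem e_g_far {i j : Fin (n - 1)} (h : Far i j) : e d i * g d j = g d j * e d i := by
  have h1 := g_ee (d := d) j (lo i) (hi i)
  unfold Far at h
  rw [s_of_ne, s_of_ne] at h1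
  · exact h1.eq.symm
  all_goals simp only [ne_eq, Fin.ext_iff, lo, hi]; omega

end YB

section Natural

variable (d n : ℕ) [NeZero n]

/-- The images of the generators of `E_n^B` in `Y_{d,n}^B`. -/
def naturalGen : BTGen n → YB d n
  | .B => YB.b d n
  | .T i => YB.g d i
  | .F j => YB.f d j
  | .E i => YB.e d i

variable {d n}

theorem naturalGen_rel (hd : (d : K) ≠ 0) ⦃x y : BTFree.Alg n⦄ (h : BTRel n x y) :
    FreeAlgebra.lift K (naturalGen d n) x = FreeAlgebra.lift K (naturalGen d n) y := by
  cases h <;> simp only [map_mul, map_pow, map_add, map_one, map_smul, BTFree.B, BTFree.T,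
    BTFree.F, BTFree.E, FreeAlgebra.lift_ι_apply, naturalGen]
  case T_far i j h => exact YB.g_far h
  case T_braid i j h => exact YB.g_braid (.inl h)
  case T_sq i => exact YB.g_sq i
  case E_sq i => rw [sq]; exact YB.ee_mul_self hd _ _
  case E_E i j => exact YB.ee_commute _ _ _ _
  case E_T i => exact YB.e_g
  case E_T_far i j h => exact YB.e_g_far h
  case E_E_T i j h => exact YB.e_e_g h
  case T_E_E i j h => exact YB.g_e_e h
  case E_T_T i j h => exact YB.e_g_g h
  case B_braid i h => exact YB.b_braid h
  case B_T i h => exact YB.b_g h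
  case B_sq => exact YB.b_sq
  case B_E i => exact YB.b_ee _ _
  case F_sq j => rw [sq]; exact YB.f_mul_self hd j
  case B_F j => exact YB.b_f j
  case F_E j i => exact YB.f_ee _ _ _
  case F_T j i => rw [(YB.g_f i (s i j)).eq, s_s]
  case E_F_lo i => rw [YB.f_mul_f]; exact (YB.f_ee _ _ _).symm
  case E_F_hi i =>
    rw [YB.f_mul_f]
    exact (YB.f_ee _ _ _).trans (YB.ee_mul_f _ _).symm

/-- The natural homomorphism `E_n^B → Y_{d,n}^B`. -/
def natural (hd : (d : K) ≠ 0) : BT n →ₐ[K] YB d n :=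
  RingQuot.liftAlgHom K ⟨FreeAlgebra.lift K (naturalGen d n), naturalGen_rel hd⟩

theorem natural_isNatural (hd : (d : K) ≠ 0) : IsNatural (natural (n := n) hd) := by
  have h : ∀ x : BTGen n, natural hd (BT.mk n (FreeAlgebra.ι K x)) = naturalGen d n x := fun x =>
    (RingQuot.liftAlgHom_mkAlgHom_apply _ _ (naturalGen_rel hd) _).trans
      (FreeAlgebra.lift_ι_apply _ _)
  exact ⟨fun i => h (.T i), fun i => h (.E i), fun j => h (.F j), h .B⟩

theorem IsNatural.unique {φ ψ : BT n →ₐ[K] YB d n} (hφ : IsNatural φ) (hψ : IsNatural ψ) :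
    φ = ψ := by
  refine RingQuot.ringQuot_ext' _ _ _ (FreeAlgebra.hom_ext (funext fun x => ?_))
  cases x with
  | B => exact hφ.2.2.2.trans hψ.2.2.2.symm
  | T i => exact (hφ.1 i).trans (hψ.1 i).symm
  | F j => exact (hφ.2.2.1 j).trans (hψ.2.2.1 j).symm
  | E i => exact (hφ.2.1 i).trans (hψ.2.1 i).symm

end Natural

/-! ### Signed permutations as words -/

/-- Signed permutations of `{1, …, n}`, as words of nonzero integers with distinct absolute
values. -/
def SWord (n : ℕ) : Type :=
  {a : Fin n → ℤ // Function.Injective (fun i => (a i).natAbs) ∧ ∀ i, a i ≠ 0 ∧ a i ≤ n ∧ -a i ≤ n}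

namespace SWord

variable {n : ℕ}

instance : CoeFun (SWord n) fun _ => Fin n → ℤ := ⟨Subtype.val⟩

@[ext] theorem ext {a b : SWord n} (h : ∀ i, a i = b i) : a = b := Subtype.ext (funext h)

theorem natAbs_injective (a : SWord n) : Function.Injective fun i => (a i).natAbs := a.2.1

theorem ne_zero (a : SWord n) (i : Fin n) : a i ≠ 0 := (a.2.2 i).1

theorem apply_ne (a : SWord n) {i j : Fin n} (h : i ≠ j) : a i ≠ a j ∧ a i ≠ -a j :=
  ⟨fun e => h (a.natAbs_injective (by simp [e])), fun e => h (a.natAbs_injective (by simp [e]))⟩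

/-- Exchange of two adjacent letters. -/
def sw (i : Fin (n - 1)) (a : SWord n) : SWord n :=
  ⟨fun j => a (s i j), a.natAbs_injective.comp (s i).injective, fun _ => a.2.2 _⟩

theorem sw_apply (i : Fin (n - 1)) (a : SWord n) (j : Fin n) : sw i a j = a (s i j) := rfl

@[simp] theorem sw_lo (i : Fin (n - 1)) (a : SWord n) : sw i a (lo i) = a (hi i) := by
  rw [sw_apply, s_lo]

@[simp] theorem sw_hi (i : Fin (n - 1)) (a : SWord n) : sw i a (hi i) = a (lo i) := by
  rw [sw_apply, s_hi]

theorem sw_of_ne {i : Fin (n - 1)} {j : Fin n} (a : SWord n) (h₁ : j ≠ lo i) (h₂ : j ≠ hi i) :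
    sw i a j = a j := by
  rw [sw_apply, s_of_ne h₁ h₂]

@[simp] theorem sw_sw (i : Fin (n - 1)) (a : SWord n) : sw i (sw i a) = a :=
  ext fun j => by simp [sw_apply]

theorem s_far {i j : Fin (n - 1)} (h : Far i j) : s i * s j = s j * s i := by
  unfold Far at h
  conv_lhs => rw [s.eq_1 j, Equiv.mul_swap_eq_swap_mul]
  rw [s_of_ne, s_of_ne, ← s]
  all_goals simp only [ne_eq, Fin.ext_iff, lo, hi]; omega

theorem s_braid {i j : Fin (n - 1)} (h : i.val + 1 = j.val) :
    s i * s j * s i = s j * s i * s j := by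
  have e := hi_eq_lo h
  have h1 : s i * s j = Equiv.swap (lo i) (hi j) * s i := by
    conv_lhs => rw [s.eq_1 j, Equiv.mul_swap_eq_swap_mul]
    rw [← e, s_hi, s_of_ne] <;> simp only [ne_eq, Fin.ext_iff, lo, hi] <;> omega
  have h2 : s j * s i = Equiv.swap (lo i) (hi j) * s j := by
    conv_lhs => rw [s.eq_1 i, Equiv.mul_swap_eq_swap_mul]
    rw [e, s_lo, s_of_ne] <;> simp only [ne_eq, Fin.ext_iff, lo, hi] <;> omega
  rw [h1, h2, mul_assoc, mul_assoc, s, s, Equiv.swap_mul_self, Equiv.swap_mul_self]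

theorem sw_far {i j : Fin (n - 1)} (h : Far i j) (a : SWord n) :
    sw i (sw j a) = sw j (sw i a) :=
  ext fun x => congrArg a (Equiv.congr_fun (s_far h).symm x)

theorem sw_braid {i j : Fin (n - 1)} (h : i.val + 1 = j.val) (a : SWord n) :
    sw i (sw j (sw i a)) = sw j (sw i (sw j a)) :=
  ext fun x => congrArg a (Equiv.congr_fun (s_braid h) x)

/-- A weight that grows when a descent is removed. -/
def wt (a : SWord n) : ℤ := ∑ j : Fin n, ((j : ℤ) + 1) * a j

/-- A measure that drops when a descent is removed. -/
def height (a : SWord n) : ℕ := ((∑ j : Fin n, ((j : ℤ) + 1) * n) - wt a).toNat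

theorem height_lt {a b : SWord n} (h : wt a < wt b) : height b < height a := by
  have : wt b ≤ ∑ j : Fin n, ((j : ℤ) + 1) * n := Finset.sum_le_sum fun j _ =>
    mul_le_mul_of_nonneg_left (b.2.2 j).2.1 (by positivity)
  unfold height
  omega

theorem height_sw {i : Fin (n - 1)} {a : SWord n} (h : a (hi i) < a (lo i)) :
    height (sw i a) < height a := by
  refine height_lt (sub_pos.1 ?_)
  have h1 : wt (sw i a) = ∑ j : Fin n, ((s i j : Fin n) + 1 : ℤ) * a j :=
    Fintype.sum_equiv (s i) _ _ fun j => by rw [s_s, sw_apply]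
  rw [h1, wt, ← Finset.sum_sub_distrib, Fintype.sum_eq_add (lo i) (hi i) (lo_ne_hi i)]
  · rw [s_lo, s_hi]; simp only [lo, hi]; push_cast; simp only [lo, hi] at h; linarith
  · rintro j ⟨h1, h2⟩; rw [s_of_ne h1 h2, sub_self]

variable [NeZero n]

/-- Change of the sign of the first letter. -/
def fl (a : SWord n) : SWord n :=
  ⟨fun j => if j = 0 then -a j else a j, by
    have h : (fun j => (if j = 0 then -a j else a j).natAbs) = fun j => (a j).natAbs := by
      funext j; split_ifs <;> simp
    rw [h]; exact a.natAbs_injective, fun j => by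
    have := a.2.2 j
    dsimp only
    split_ifs
    · exact ⟨neg_ne_zero.2 this.1, this.2.2, by rw [neg_neg]; exact this.2.1⟩
    · exact this⟩

theorem fl_apply (a : SWord n) (j : Fin n) : fl a j = if j = 0 then -a j else a j := rfl

@[simp] theorem fl_zero (a : SWord n) : fl a 0 = -a 0 := by simp [fl_apply]

theorem fl_of_ne {j : Fin n} (a : SWord n) (h : j ≠ 0) : fl a j = a j := by simp [fl_apply, h]

theorem natAbs_fl (a : SWord n) (j : Fin n) : (fl a j).natAbs = (a j).natAbs := by
  rw [fl_apply]; split_ifs <;> simp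

@[simp] theorem fl_fl (a : SWord n) : fl (fl a) = a :=
  ext fun j => by simp only [fl_apply]; split_ifs <;> simp

theorem lo_eq_zero {i : Fin (n - 1)} (h : i.val = 0) : lo i = 0 := by simp [lo, h]

theorem hi_ne_zero (i : Fin (n - 1)) : hi i ≠ 0 := by simp [Fin.ext_iff, hi]

theorem lo_ne_zero {i : Fin (n - 1)} (h : i.val ≠ 0) : lo i ≠ 0 := by simp [Fin.ext_iff, lo, h]

theorem fl_sw {i : Fin (n - 1)} (h : i.val ≠ 0) (a : SWord n) : fl (sw i a) = sw i (fl a) :=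
  ext fun j => by
    have : s i j = 0 ↔ j = 0 := by
      conv_lhs => rw [← s_of_ne (lo_ne_zero h).symm (hi_ne_zero i).symm]
      exact (s i).apply_eq_iff_eq
    simp only [fl_apply, sw_apply, this]

theorem fl_braid {i : Fin (n - 1)} (h : i.val = 0) (a : SWord n) :
    fl (sw i (fl (sw i a))) = sw i (fl (sw i (fl a))) :=
  ext fun j => by
    have h0 := lo_eq_zero h
    have h1 : s i 0 = hi i := by rw [← h0, s_lo]
    have h2 : s i (hi i) = 0 := by rw [s_hi, h0]
    by_cases hj : j = 0
    · subst hj; simp [fl_apply, sw_apply, hi_ne_zero, h1, h2]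
    · by_cases hj' : j = hi i
      · subst hj'; simp [fl_apply, sw_apply, hi_ne_zero, h1, h2]
      · simp [fl_apply, sw_apply, s_of_ne (h0 ▸ hj) hj', hj]

/-- The identity word `1 2 … n`. -/
def id (n : ℕ) : SWord n :=
  ⟨fun j => j.val + 1, fun i j h => by simp only [Fin.ext_iff] at *; omega, fun j => by
    have := j.2; dsimp only; omega⟩

/-- The word is strictly increasing with positive letters at most `n`. Counting up from the left end
bounds each letter below, counting down from the right end bounds it above, and the bounds coincide.
-/
theorem eq_id (a : SWord n) (h₀ : 0 < a 0) (h : ∀ i, a (lo i) ≤ a (hi i)) : a = id n := by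
  obtain ⟨m, rfl⟩ : ∃ m, n = m + 1 := ⟨n - 1, by have := NeZero.pos n; omega⟩
  have hm : StrictMono a.1 := Fin.strictMono_iff_lt_succ.2 fun i =>
    lt_of_le_of_ne (h i) (a.apply_ne (lo_ne_hi (n := m + 1) i)).1
  have h1 : ∀ (k : ℕ) (hk : k < m + 1), (k : ℤ) + 1 ≤ a ⟨k, hk⟩ := by
    intro k
    induction k with
    | zero => intro _; have h₀' : 1 ≤ a 0 := h₀; simpa using h₀'
    | succ k ih =>
      intro hk
      have := ih (by omega)
      have h2 : a ⟨k, by omega⟩ < a ⟨k + 1, hk⟩ := hm (by simp)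
      push_cast; omega
  have h2 : ∀ (k : ℕ) (hk : k < m + 1), a ⟨m - k, by omega⟩ ≤ (m : ℤ) + 1 - k := by
    intro k
    induction k with
    | zero => intro _; have := (a.2.2 ⟨m - 0, by omega⟩).2.1; push_cast at this ⊢; omega
    | succ k ih =>
      intro hk
      have := ih (by omega)
      have h2 : a ⟨m - (k + 1), by omega⟩ < a ⟨m - k, by omega⟩ := hm (by simp; omega)
      push_cast; omega
  refine ext fun j => le_antisymm ?_ (h1 j.1 j.2)
  have h3 := h2 (m - j.1) (by omega)
  have h4 : (⟨m - (m - j.1), by omega⟩ : Fin (m + 1)) = j := Fin.ext (by simp; omega)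
  rw [h4] at h3
  change a j ≤ (j.val : ℤ) + 1
  omega

theorem height_fl {a : SWord n} (h : a 0 < 0) : height (fl a) < height a := by
  refine height_lt (sub_pos.1 ?_)
  rw [wt, wt, ← Finset.sum_sub_distrib, Fintype.sum_eq_single 0]
  · rw [fl_zero]; simp; linarith
  · intro j hj; rw [fl_of_ne a hj, sub_self]

end SWord

/-! ### The standard basis elements attached to signed permutations -/

section Tau

open SWord

variable {n : ℕ} [NeZero n] {M : Type*} [Monoid M]

/-- The braid relations of type B. -/
structure IsBraidB (T : Fin (n - 1) → M) (B : M) : Prop where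
  far : ∀ i j, Far i j → T i * T j = T j * T i
  braid : ∀ i j : Fin (n - 1), i.val + 1 = j.val → T i * T j * T i = T j * T i * T j
  B_braid : ∀ i : Fin (n - 1), i.val = 0 → B * T i * B * T i = T i * B * T i * B
  B_T : ∀ i : Fin (n - 1), i.val ≠ 0 → B * T i = T i * B

open Classical in
/-- The product of the generators along a reduced expression of a signed permutation. -/
def tau (T : Fin (n - 1) → M) (B : M) (a : SWord n) : M :=
  if h : ∃ i, a (hi i) < a (lo i) then T h.choose * tau T B (sw h.choose a)
  else if _h0 : a 0 < 0 then B * tau T B (fl a) else 1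
termination_by height a
decreasing_by
  · exact height_sw h.choose_spec
  · exact height_fl _h0

variable {T : Fin (n - 1) → M} {B : M}

theorem tau_id : tau T B (SWord.id n) = 1 := by
  rw [tau, dif_neg, dif_neg]
  · simp [SWord.id]
  · simp [SWord.id, lo, hi]

/-- Independence of the reduced expression: the recursion defining `tau` chooses one descent, but
any descent may be removed first. This is a diamond argument by induction on `height`. Two removals
from the same word are continued until they meet, and the resulting products agree by the braid
relation of the rank two subgroup involved. -/
theorem tau_descent (hb : IsBraidB T B) (a : SWord n) :
    (∀ i, a (hi i) < a (lo i) → tau T B a = T i * tau T B (sw i a)) ∧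
      (a 0 < 0 → tau T B a = B * tau T B (fl a)) := by
  induction hm : height a using Nat.strong_induction_on generalizing a with
  | _ m ih =>
  subst hm
  have ihT : ∀ b : SWord n, height b < height a → ∀ i, b (hi i) < b (lo i) →
      tau T B b = T i * tau T B (sw i b) := fun b hb => (ih _ hb b rfl).1
  have ihB : ∀ b : SWord n, height b < height a → b 0 < 0 → tau T B b = B * tau T B (fl b) :=
    fun b hb => (ih _ hb b rfl).2
  -- Here three consecutive letters decrease, so both branches remove two further descents and meet
  -- at the reversed triple, where the length three braid relation applies.
  have near : ∀ i j : Fin (n - 1), i.val + 1 = j.val → a (hi i) < a (lo i) → a (hi j) < a (lo j) →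
      T i * tau T B (sw i a) = T j * tau T B (sw j a) := by
    intro i j h hai haj
    have e1 := hi_eq_lo h
    have e2 : ∀ b : SWord n, sw i b (hi j) = b (hi j) := fun b => sw_of_ne b
      (by simp [Fin.ext_iff, lo, hi]; omega) (by simp [Fin.ext_iff, hi]; omega)
    have e3 : ∀ b : SWord n, sw j b (lo i) = b (lo i) := fun b => sw_of_ne b
      (by simp [Fin.ext_iff, lo]; omega) (by simp [Fin.ext_iff, lo, hi]; omega)
    have hl := height_sw hai
    have hl' := height_sw haj
    have d1 : sw i a (hi j) < sw i a (lo j) := by rw [e2, ← e1, sw_hi]; rw [← e1] at haj; omega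
    have d2 : sw j (sw i a) (hi i) < sw j (sw i a) (lo i) := by
      rw [e3, sw_lo, e1, sw_lo, e2]; exact haj
    have d1' : sw j a (hi i) < sw j a (lo i) := by rw [e3, e1, sw_lo]; rw [← e1] at haj; omega
    have d2' : sw i (sw j a) (hi j) < sw i (sw j a) (lo j) := by
      rw [e2, sw_hi, ← e1, sw_hi, e3]; exact hai
    rw [ihT _ hl j d1, ihT _ ((height_sw d1).trans hl) i d2, ihT _ hl' i d1',
      ihT _ ((height_sw d1').trans hl') j d2', sw_braid h]
    simp only [← mul_assoc]
    rw [hb.braid i j h]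
  have key : ∀ i j : Fin (n - 1), a (hi i) < a (lo i) → a (hi j) < a (lo j) →
      T i * tau T B (sw i a) = T j * tau T B (sw j a) := by
    intro i j hai haj
    by_cases hf : Far i j
    · have hl := height_sw hai
      have hl' := height_sw haj
      have hf' := hf
      unfold Far at hf'
      have d1 : sw i a (hi j) < sw i a (lo j) := by
        rwa [sw_of_ne, sw_of_ne] <;> simp only [ne_eq, Fin.ext_iff, lo, hi] <;> omega
      have d1' : sw j a (hi i) < sw j a (lo i) := by
        rwa [sw_of_ne, sw_of_ne] <;> simp only [ne_eq, Fin.ext_iff, lo, hi] <;> omega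
      rw [ihT _ hl j d1, ihT _ hl' i d1', sw_far hf, ← mul_assoc, ← mul_assoc, hb.far i j hf]
    · unfold Far at hf
      rcases (by omega : i.val + 1 = j.val ∨ j.val + 1 = i.val ∨ i.val = j.val) with h | h | h
      · exact near i j h hai haj
      · exact (near j i h haj hai).symm
      · rw [Fin.ext h]
  -- For `i = 0` the first two letters satisfy `a 1 < a 0 < 0`; each branch has three more removals,
  -- and the length four relation closes the diamond. For other `i` the two removals commute.
  have keyB : ∀ i : Fin (n - 1), a (hi i) < a (lo i) → a 0 < 0 →
      T i * tau T B (sw i a) = B * tau T B (fl a) := by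
    intro i hai h0
    have hl := height_sw hai
    have hl' := height_fl h0
    by_cases h : i.val = 0
    · have e0 := lo_eq_zero h
      have e1 : ∀ b : SWord n, fl b (hi i) = b (hi i) := fun b => fl_of_ne b (hi_ne_zero i)
      have e2 : ∀ b : SWord n, sw i b 0 = b (hi i) := fun b => by rw [← e0, sw_lo]
      have e3 : ∀ b : SWord n, sw i b (hi i) = b 0 := fun b => by rw [sw_hi, e0]
      rw [e0] at hai
      have d1 : sw i a 0 < 0 := by rw [e2]; omega
      have d2 : fl (sw i a) (hi i) < fl (sw i a) (lo i) := by
        rw [e0, e1, fl_zero, e2, e3]; omega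
      have d3 : sw i (fl (sw i a)) 0 < 0 := by rw [e2, e1, e3]; omega
      have d1' : fl a (hi i) < fl a (lo i) := by rw [e0, e1, fl_zero]; omega
      have d2' : sw i (fl a) 0 < 0 := by rw [e2, e1]; omega
      have d3' : fl (sw i (fl a)) (hi i) < fl (sw i (fl a)) (lo i) := by
        rw [e0, e1, fl_zero, e2, e3, e1, fl_zero]; omega
      have l1 := (height_fl d1).trans hl
      have l1' := (height_sw d1').trans hl'
      rw [ihB _ hl d1, ihT _ l1 i d2, ihB _ ((height_sw d2).trans l1) d3, ihT _ hl' i d1',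
        ihB _ l1' d2', ihT _ ((height_fl d2').trans l1') i d3', fl_braid h]
      simp only [← mul_assoc]
      rw [hb.B_braid i h]
    · have d1 : sw i a 0 < 0 := by
        rwa [sw_of_ne a (lo_ne_zero h).symm (hi_ne_zero i).symm]
      have d1' : fl a (hi i) < fl a (lo i) := by
        rwa [fl_of_ne a (hi_ne_zero i), fl_of_ne a (lo_ne_zero h)]
      rw [ihB _ hl d1, ihT _ hl' i d1', fl_sw h, ← mul_assoc, ← mul_assoc, hb.B_T i h]
  have unfold_tau := tau.eq_1 T B a
  split_ifs at unfold_tau with hT h0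
  · exact ⟨fun i hi => unfold_tau.trans (key _ _ hT.choose_spec hi),
      fun h0 => unfold_tau.trans (keyB _ hT.choose_spec h0)⟩
  · exact ⟨fun i hi => (hT ⟨i, hi⟩).elim, fun _ => unfold_tau⟩
  · exact ⟨fun i hi => (hT ⟨i, hi⟩).elim, fun h => (h0 h).elim⟩

end Tau

/-! ### Representations on the span of the signed permutations -/

section Rep

open SWord

variable {k : Type*} [Field k] {n : ℕ}

/-- The vector of a signed permutation. -/
def vec (k : Type*) [Field k] (a : SWord n) : SWord n →₀ k := Finsupp.single a 1

theorem endomorphism_ext {f g : Module.End k (SWord n →₀ k)} (h : ∀ a, f (vec k a) = g (vec k a)) :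
    f = g :=
  Finsupp.lhom_ext' fun a => LinearMap.ext_ring (h a)

open Classical in
/-- The scalar by which `g_i` differs from an exchange of adjacent letters `x`, `y`. -/
def coefG (χ : ℕ → k) (q : k) (x y : ℤ) : k :=
  if χ x.natAbs = χ y.natAbs ∧ y < x then q else 0

open Classical in
/-- The scalar by which `b` differs from a change of sign of the first letter `x`. -/
def coefB (χ : ℕ → k) (q : k) (x : ℤ) : k := if χ x.natAbs = 1 ∧ x < 0 then q else 0

open Classical in
/-- The Kronecker delta. -/
def delta (x y : k) : k := if x = y then 1 else 0

/-- The action of `g_i`. -/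
def opG (χ : ℕ → k) (q : k) (i : Fin (n - 1)) : Module.End k (SWord n →₀ k) :=
  Finsupp.linearCombination k fun a => vec k (sw i a) + coefG χ q (a (lo i)) (a (hi i)) • vec k a

/-- The action of `t_j`. -/
def opT (χ : ℕ → k) (j : Fin n) : Module.End k (SWord n →₀ k) :=
  Finsupp.linearCombination k fun a => χ (a j).natAbs • vec k a

/-- The action of `b`. -/
def opB [NeZero n] (χ : ℕ → k) (q : k) : Module.End k (SWord n →₀ k) :=
  Finsupp.linearCombination k fun a => vec k (fl a) + coefB χ q (a 0) • vec k a

variable {χ : ℕ → k} {q q' : k}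

theorem opG_vec (i : Fin (n - 1)) (a : SWord n) :
    opG χ q i (vec k a) = vec k (sw i a) + coefG χ q (a (lo i)) (a (hi i)) • vec k a := by
  simp [opG, vec]

theorem opT_vec (j : Fin n) (a : SWord n) : opT χ j (vec k a) = χ (a j).natAbs • vec k a := by
  simp [opT, vec]

theorem opB_vec [NeZero n] (a : SWord n) :
    opB χ q (vec k a) = vec k (fl a) + coefB χ q (a 0) • vec k a := by
  simp [opB, vec]

theorem opG_far {i j : Fin (n - 1)} (h : Far i j) :
    opG χ q i * opG χ q j = opG χ q j * opG χ q i := endomorphism_ext fun a => by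
  have e : ∀ {i j : Fin (n - 1)}, Far i j →
      sw i a (lo j) = a (lo j) ∧ sw i a (hi j) = a (hi j) := by
    intro i j h
    unfold Far at h
    constructor <;> apply sw_of_ne <;> simp only [ne_eq, Fin.ext_iff, lo, hi] <;> omega
  simp only [Module.End.mul_apply, opG_vec, map_add, map_smul, sw_far h a, e h, e h.symm]
  module

/-- After expansion, the two sides differ only in the coefficients of three words. Each comparison
is a finite case check on the order and colours of three distinct letters. -/
theorem opG_braid {i j : Fin (n - 1)} (h : i.val + 1 = j.val) :
    opG χ q i * opG χ q j * opG χ q i = opG χ q j * opG χ q i * opG χ q j :=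
  endomorphism_ext fun a => by
  have e1 := hi_eq_lo h
  have e2 : ∀ b : SWord n, sw i b (hi j) = b (hi j) := fun b => sw_of_ne b
    (by simp [Fin.ext_iff, lo, hi]; omega) (by simp [Fin.ext_iff, hi]; omega)
  have e3 : ∀ b : SWord n, sw j b (lo i) = b (lo i) := fun b => sw_of_ne b
    (by simp [Fin.ext_iff, lo]; omega) (by simp [Fin.ext_iff, lo, hi]; omega)
  have e4 : ∀ b : SWord n, sw i b (lo j) = b (lo i) := fun b => by rw [← e1, sw_hi]
  have e5 : ∀ b : SWord n, sw j b (lo j) = b (hi j) := fun b => sw_lo j b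
  have e6 : ∀ b : SWord n, sw j b (hi j) = b (lo j) := fun b => sw_hi j b
  have e7 : ∀ b : SWord n, sw i b (lo i) = b (lo j) := fun b => by rw [sw_lo, e1]
  simp only [Module.End.mul_apply, opG_vec, map_add, map_smul, sw_braid h a, e1, e2, e3,
    e4, e5, e6, e7, sw_sw, smul_add, smul_smul]
  have hxy := (a.apply_ne (i := lo i) (j := lo j) (by simp [Fin.ext_iff, lo]; omega)).1
  have hyz := (a.apply_ne (i := lo j) (j := hi j) (by simp [Fin.ext_iff, lo, hi])).1
  have hxz := (a.apply_ne (i := lo i) (j := hi j) (by simp [Fin.ext_iff, lo, hi]; omega)).1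
  generalize a (lo i) = x at *
  generalize a (lo j) = y at *
  generalize a (hi j) = z at *
  have h1 : coefG χ q x z * coefG χ q y x + coefG χ q x y * coefG χ q y z =
      coefG χ q y z * coefG χ q x z := by grind [coefG]
  have h2 : coefG χ q x y * coefG χ q x z =
      coefG χ q x z * coefG χ q z y + coefG χ q y z * coefG χ q x y := by grind [coefG]
  have h3 : coefG χ q x y * coefG χ q x y * coefG χ q y z =
      coefG χ q y z * coefG χ q y z * coefG χ q x y := by grind [coefG]
  linear_combination (norm := module) h1 • vec k (sw i a) + h2 • vec k (sw j a) + h3 • vec k a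

theorem opB_opG [NeZero n] {i : Fin (n - 1)} (h : i.val ≠ 0) :
    opB χ q' * opG χ q i = opG χ q i * opB χ q' := endomorphism_ext fun a => by
  have e1 : sw i a 0 = a 0 := sw_of_ne a (lo_ne_zero h).symm (hi_ne_zero i).symm
  simp only [Module.End.mul_apply, opG_vec, opB_vec, map_add, map_smul, fl_sw h a, e1,
    fl_of_ne a (lo_ne_zero h), fl_of_ne a (hi_ne_zero i)]
  module

/-- The same method with two letters `x`, `y`. Colours depend only on absolute values, so changing
signs affects only the order; the case check needs `x ≠ ±y` and both letters nonzero. -/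
theorem opB_braid [NeZero n] {i : Fin (n - 1)} (h : i.val = 0) :
    opB χ q' * opG χ q i * opB χ q' * opG χ q i = opG χ q i * opB χ q' * opG χ q i * opB χ q' :=
  endomorphism_ext fun a => by
  have e0 := lo_eq_zero h
  have e1 : ∀ b : SWord n, fl b (hi i) = b (hi i) := fun b => fl_of_ne b (hi_ne_zero i)
  have e2 : ∀ b : SWord n, sw i b 0 = b (hi i) := fun b => by rw [← e0, sw_lo]
  have e3 : ∀ b : SWord n, sw i b (hi i) = b 0 := fun b => by rw [sw_hi, e0]
  simp only [Module.End.mul_apply, opG_vec, opB_vec, map_add, map_smul, fl_braid h a, e0, e1, e2,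
    e3, sw_sw, fl_fl, fl_zero, smul_add, smul_smul]
  have hxy := a.apply_ne (hi_ne_zero i).symm
  have hx := a.ne_zero 0
  have hy := a.ne_zero (hi i)
  generalize a 0 = x at *
  generalize a (hi i) = y at *
  have h1 : coefG χ q x y = coefG χ q (-y) (-x) := by grind [coefG]
  have h2 : coefG χ q x y * coefB χ q' y = coefB χ q' y * coefG χ q y (-x) +
      coefG χ q (-x) y * coefB χ q' (-x) + coefB χ q' x * coefG χ q x y := by
    grind [coefG, coefB]
  have h3 : coefG χ q x y * coefG χ q (-x) y * coefB χ q' (-x) +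
      coefG χ q x y * coefG χ q x y * coefB χ q' x =
      coefG χ q (-x) y * coefG χ q (-x) y * coefB χ q' (-x) +
      coefB χ q' x * coefG χ q x y * coefG χ q (-x) y := by
    grind [coefG, coefB]
  have h4 : coefG χ q (-y) x * coefB χ q' (-y) + coefB χ q' y * coefG χ q y x +
      coefG χ q x y * coefB χ q' x = coefB χ q' x * coefG χ q (-y) x := by
    grind [coefG, coefB]
  have h5 : coefG χ q (-y) x = coefG χ q (-x) y := by grind [coefG]
  have h6 : coefB χ q' y * coefB χ q' y * coefG χ q y x +
      coefG χ q x y * coefB χ q' x * coefB χ q' y =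
      coefB χ q' x * coefB χ q' y * coefG χ q y x +
      coefB χ q' x * coefB χ q' x * coefG χ q x y := by
    clear h1 h2 h3 h4 h5
    grind [coefG, coefB]
  linear_combination (norm := module) h1 • vec k (fl (sw i (fl a))) + h2 • vec k (sw i (fl a)) +
    h3 • vec k (fl a) + h4 • vec k (fl (sw i a)) + (h5 + h6) • vec k (sw i a)

theorem opT_opT (i j : Fin n) : opT χ i * opT χ j = opT χ j * opT χ i :=
  endomorphism_ext fun a => by
  simp only [Module.End.mul_apply, opT_vec, map_smul, smul_smul, mul_comm]

theorem opT_opG (j : Fin n) (i : Fin (n - 1)) :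
    opT χ j * opG χ q i = opG χ q i * opT χ (s i j) := endomorphism_ext fun a => by
  simp only [Module.End.mul_apply, opT_vec, opG_vec, map_add, map_smul, smul_add, smul_smul,
    sw_apply]
  congr 1
  -- At the exchanged positions the correction term is nonzero only when both letters have the same
  -- colour, so either eigenvalue may be used.
  by_cases hj : j = lo i ∨ j = hi i
  · unfold coefG
    rcases hj with rfl | rfl <;> split_ifs with h <;> simp_all [mul_comm]
  · rw [not_or] at hj
    rw [s_of_ne hj.1 hj.2, mul_comm]

theorem opT_opB [NeZero n] (j : Fin n) : opT χ j * opB χ q = opB χ q * opT χ j :=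
  endomorphism_ext fun a => by
  simp only [Module.End.mul_apply, opT_vec, opB_vec, map_add, map_smul, smul_add, smul_smul,
    natAbs_fl, mul_comm]

theorem pow_apply_of_eigen {V : Type*} [AddCommGroup V] [Module k V] {f : Module.End k V} {x : k}
    {w : V} (h : f w = x • w) (m : ℕ) : (f ^ m) w = x ^ m • w := by
  induction m with
  | zero => simp
  | succ m ih => rw [pow_succ, Module.End.mul_apply, h, map_smul, ih, smul_smul, ← pow_succ']

theorem avg_apply_of_eigen {V : Type*} [AddCommGroup V] [Module k V] {f g : Module.End k V}
    {x y : k} {w : V} (hf : f w = x • w) (hg : g w = y • w) (d : ℕ) :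
    avg k d f g w = avg k d x y • w := by
  simp only [avg, LinearMap.smul_apply, LinearMap.sum_apply, Module.End.mul_apply,
    pow_apply_of_eigen hg, map_smul, pow_apply_of_eigen hf, smul_smul, ← Finset.sum_smul,
    smul_eq_mul, mul_comm]

/-- If `x ≠ y`, then `x · avg = avg · y` forces the average to vanish, as the scalars form a field.
-/
theorem avg_field {d : ℕ} (hd : (d : k) ≠ 0) {x y : k} (hx : x ^ d = 1) (hy : y ^ d = 1) :
    avg k d x y = delta x y := by
  unfold delta
  split_ifs with h
  · rw [h, avg_self hd hy]
  · have h1 := mul_avg (k := k) hx hy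
    rw [mul_comm (avg k d x y), ← sub_eq_zero, ← sub_mul] at h1
    exact (mul_eq_zero.1 h1).resolve_left (sub_ne_zero.2 h)

theorem opT_pow {d : ℕ} (hχ : ∀ m, χ m ^ d = 1) (j : Fin n) : opT χ j ^ d = 1 :=
  endomorphism_ext fun a => by
  rw [pow_apply_of_eigen (opT_vec j a), hχ, one_smul, Module.End.one_apply]

theorem avg_opT_vec {d : ℕ} (hd : (d : k) ≠ 0) (hχ : ∀ m, χ m ^ d = 1) (i j : Fin n) (a : SWord n) :
    avg k d (opT χ i) (opT χ j) (vec k a) =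
      delta (χ (a i).natAbs) (χ (a j).natAbs) • vec k a := by
  rw [avg_apply_of_eigen (opT_vec i a) (opT_vec j a), avg_field hd (hχ _) (hχ _)]

theorem avg_opT_one_vec {d : ℕ} (hd : (d : k) ≠ 0) (hχ : ∀ m, χ m ^ d = 1) (j : Fin n)
    (a : SWord n) :
    avg k d (opT χ j) 1 (vec k a) = delta (χ (a j).natAbs) 1 • vec k a := by
  rw [avg_apply_of_eigen (opT_vec j a) (y := 1) (by simp), avg_field hd (hχ _) (one_pow d)]

theorem opG_sq {d : ℕ} (hd : (d : k) ≠ 0) (hχ : ∀ m, χ m ^ d = 1) (i : Fin (n - 1)) :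
    opG χ q i ^ 2 = 1 + q • (avg k d (opT χ (lo i)) (opT χ (hi i)) * opG χ q i) :=
  endomorphism_ext fun a => by
  simp only [sq, Module.End.mul_apply, opG_vec, map_add, map_smul, LinearMap.add_apply,
    LinearMap.smul_apply, Module.End.one_apply, avg_opT_vec hd hχ, sw_sw, sw_lo, sw_hi]
  have hne := (a.apply_ne (lo_ne_hi i)).1
  generalize a (lo i) = x at *
  generalize a (hi i) = y at *
  -- Of two distinct letters exactly one order is a descent, so exactly one of the two terms equals
  -- `q` when the colours agree.
  have h1 : coefG χ q y x + coefG χ q x y = q * delta (χ y.natAbs) (χ x.natAbs) := by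
    grind [coefG, delta]
  have h2 : coefG χ q x y * coefG χ q x y =
      q * coefG χ q x y * delta (χ x.natAbs) (χ y.natAbs) := by
    grind [coefG, delta]
  linear_combination (norm := module) h1 • vec k (sw i a) + h2 • vec k a

theorem opB_sq [NeZero n] {d : ℕ} (hd : (d : k) ≠ 0) (hχ : ∀ m, χ m ^ d = 1) :
    opB (n := n) χ q ^ 2 = 1 + q • (avg k d (opT χ 0) 1 * opB χ q) :=
  endomorphism_ext fun a => by
  simp only [sq, Module.End.mul_apply, opB_vec, map_add, map_smul, LinearMap.add_apply,
    LinearMap.smul_apply, Module.End.one_apply, avg_opT_one_vec hd hχ, fl_fl, fl_zero]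
  have hne := a.ne_zero 0
  generalize a 0 = x at *
  have h1 : coefB χ q (-x) + coefB χ q x = q * delta (χ (-x).natAbs) 1 := by
    grind [coefB, delta]
  have h2 : coefB χ q x * coefB χ q x = q * coefB χ q x * delta (χ x.natAbs) 1 := by
    grind [coefB, delta]
  linear_combination (norm := module) h1 • vec k (fl a) + h2 • vec k a

end Rep

/-! ### The representations of the framization -/

section YRep

open SWord

variable {d n : ℕ} [NeZero n] {χ : ℕ → K}

/-- The images of the generators of `Y_{d,n}^B`. -/
def repGen (χ : ℕ → K) : YGen n → Module.End K (SWord n →₀ K)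
  | .t j => opT χ j
  | .g i => opG χ (u - u⁻¹) i
  | .b => opB χ (v - v⁻¹)

theorem lift_repGen_e (i : Fin (n - 1)) : FreeAlgebra.lift K (repGen χ) (YFree.e d i) =
    avg K d (opT χ (lo i)) (opT χ (hi i)) := by
  simp only [YFree.e, avg, YFree.t, map_smul, map_sum, map_mul, map_pow,
    FreeAlgebra.lift_ι_apply, repGen]

theorem lift_repGen_f (j : Fin n) : FreeAlgebra.lift K (repGen χ) (YFree.f d j) =
    avg K d (opT χ j) 1 := by
  simp only [YFree.f, avg_one_right, YFree.t, map_smul, map_sum, map_pow,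
    FreeAlgebra.lift_ι_apply, repGen]

theorem repGen_rel (hd : (d : K) ≠ 0) (hχ : ∀ m, χ m ^ d = 1) ⦃x y : YFree.Alg n⦄
    (h : YRel d n x y) :
    FreeAlgebra.lift K (repGen χ) x = FreeAlgebra.lift K (repGen χ) y := by
  cases h <;> simp only [map_mul, map_pow, map_add, map_one, map_smul, lift_repGen_e,
    lift_repGen_f, YFree.t, YFree.g, YFree.b, FreeAlgebra.lift_ι_apply, repGen]
  case g_far i j h => exact opG_far h
  case g_braid i j h =>
    rcases h with h | h
    · exact opG_braid h
    · exact (opG_braid h).symm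
  case b_g i h => exact opB_opG h
  case b_braid i h => exact opB_braid h
  case t_t i j => exact opT_opT i j
  case t_g j i => exact opT_opG j i
  case t_b j => exact opT_opB j
  case t_pow j => exact opT_pow hχ j
  case g_sq i => exact opG_sq hd hχ i
  case b_sq => exact opB_sq hd hχ

/-- The representation of `Y_{d,n}^B` attached to a colouring of `1, 2, …`. -/
def rep (hd : (d : K) ≠ 0) (hχ : ∀ m, χ m ^ d = 1) :
    YB d n →ₐ[K] Module.End K (SWord n →₀ K) :=
  RingQuot.liftAlgHom K ⟨FreeAlgebra.lift K (repGen χ), repGen_rel hd hχ⟩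

theorem rep_mk (hd : (d : K) ≠ 0) (hχ : ∀ m, χ m ^ d = 1) (x : YFree.Alg n) :
    rep hd hχ (YB.mk d n x) = FreeAlgebra.lift K (repGen χ) x :=
  RingQuot.liftAlgHom_mkAlgHom_apply _ _ (repGen_rel hd hχ) _

variable (d) in
/-- An action of `E_n^B` on the span of the signed permutations is compatible with the
colouring `χ`. -/
structure IsColouredAction (χ : ℕ → K) (ρ : BT n →ₐ[K] Module.End K (SWord n →₀ K)) : Prop where
  T : ∀ i, ρ (BT.T i) = opG χ (u - u⁻¹) i
  B : ρ (BT.B n) = opB χ (v - v⁻¹)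
  E : ∀ i, ρ (BT.E i) = avg K d (opT χ (lo i)) (opT χ (hi i))
  F : ∀ j, ρ (BT.F j) = avg K d (opT χ j) 1

theorem isColouredAction_comp (hd : (d : K) ≠ 0) (hχ : ∀ m, χ m ^ d = 1)
    {φ : BT n →ₐ[K] YB d n} (hφ : IsNatural φ) :
    IsColouredAction d χ ((rep hd hχ).comp φ) where
  T i := by
    rw [AlgHom.comp_apply, hφ.1, YB.g, rep_mk, YFree.g, FreeAlgebra.lift_ι_apply, repGen]
  B := by
    rw [AlgHom.comp_apply, hφ.2.2.2, YB.b, rep_mk, YFree.b, FreeAlgebra.lift_ι_apply, repGen]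
  E i := by rw [AlgHom.comp_apply, hφ.2.1, ← YB.mk_e, rep_mk, lift_repGen_e]
  F j := by rw [AlgHom.comp_apply, hφ.2.2.1, ← YB.mk_f, rep_mk, lift_repGen_f]

end YRep

/-! ### Relations in the algebra of braids and ties -/

namespace BT

open SWord

variable {n : ℕ} [NeZero n]

theorem mk_rel {x y : BTFree.Alg n} (h : BTRel n x y) : mk n x = mk n y :=
  RingQuot.mkAlgHom_rel K h

theorem mul_rel {x y z w : BTFree.Alg n} (h : BTRel n (x * y) (z * w)) :
    mk n x * mk n y = mk n z * mk n w := by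
  rw [← map_mul, ← map_mul]
  exact mk_rel h

theorem isBraidB : IsBraidB (T (n := n)) (B n) where
  far i j h := mul_rel (BTRel.T_far i j h)
  braid i j h := by
    have e := mk_rel (BTRel.T_braid i j h)
    simp only [map_mul] at e
    exact e
  B_braid i h := by
    have e := mk_rel (BTRel.B_braid i h)
    simp only [map_mul] at e
    exact e
  B_T i h := mul_rel (BTRel.B_T i h)

theorem T_sq (i : Fin (n - 1)) : T i * T i = 1 + (u - u⁻¹) • (E i * T i) := by
  have h := mk_rel (BTRel.T_sq i)
  rwa [sq, map_mul, map_add, map_one, map_smul, map_mul] at h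

theorem B_sq : B n * B n = 1 + (v - v⁻¹) • (F 0 * B n) := by
  have h := mk_rel (BTRel.B_sq (n := n))
  rwa [sq, map_mul, map_add, map_one, map_smul, map_mul] at h

theorem E_sq (i : Fin (n - 1)) : E i * E i = E i := by
  have h := mk_rel (BTRel.E_sq i)
  rwa [sq, map_mul] at h

theorem F_sq (j : Fin n) : F j * F j = F j := by
  have h := mk_rel (BTRel.F_sq j)
  rwa [sq, map_mul] at h

theorem E_E (i j : Fin (n - 1)) : Commute (E i) (E j) := mul_rel (BTRel.E_E i j)

theorem E_T (i : Fin (n - 1)) : Commute (E i) (T i) := mul_rel (BTRel.E_T i)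

theorem E_T_far {i j : Fin (n - 1)} (h : Far i j) : Commute (E i) (T j) :=
  mul_rel (BTRel.E_T_far i j h)

theorem E_E_T {i j : Fin (n - 1)} (h : Near i j) : E i * E j * T i = T i * E i * E j := by
  have e := mk_rel (BTRel.E_E_T i j h)
  simp only [map_mul] at e
  exact e

theorem T_E_E {i j : Fin (n - 1)} (h : Near i j) : T i * E i * E j = E j * T i * E j := by
  have e := mk_rel (BTRel.T_E_E i j h)
  simp only [map_mul] at e
  exact e

theorem E_T_T {i j : Fin (n - 1)} (h : Near i j) : E i * T j * T i = T j * T i * E j := by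
  have e := mk_rel (BTRel.E_T_T i j h)
  simp only [map_mul] at e
  exact e

theorem B_E (i : Fin (n - 1)) : Commute (B n) (E i) := mul_rel (BTRel.B_E i)

theorem B_F (j : Fin n) : Commute (B n) (F j) := mul_rel (BTRel.B_F j)

theorem F_E (j : Fin n) (i : Fin (n - 1)) : Commute (F j) (E i) := mul_rel (BTRel.F_E j i)

theorem T_F (i : Fin (n - 1)) (j : Fin n) : SemiconjBy (T i) (F j) (F (s i j)) := by
  have h := mul_rel (BTRel.F_T (s i j) i)
  rw [s_s] at h
  exact h.symm

theorem E_F_lo (i : Fin (n - 1)) : E i * F (lo i) = F (lo i) * F (hi i) :=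
  mul_rel (BTRel.E_F_lo i)

theorem E_F_hi (i : Fin (n - 1)) : F (lo i) * F (hi i) = E i * F (hi i) :=
  mul_rel (BTRel.E_F_hi i)

/-- The invertible element `T_i`. -/
def Tu (i : Fin (n - 1)) : (BT n)ˣ where
  val := T i
  inv := T i + (u⁻¹ - u) • E i
  val_inv := by
    rw [mul_add, mul_smul_comm, ← (E_T i).eq, T_sq, add_assoc, ← add_smul]
    simp
  inv_val := by
    rw [add_mul, smul_mul_assoc, T_sq, add_assoc, ← add_smul]
    simp

@[simp] theorem Tu_val (i : Fin (n - 1)) : (Tu i : BT n) = T i := rfl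

/-- `T_i` is not an involution, but its square differs from `1` by a multiple of `E_i T_i`, which
commutes with `E_j`. This is what lets conjugation by `T_i` act as an involution on ties. -/
theorem T_T_E {i j : Fin (n - 1)} (h : Near i j) : Commute (T i * T i) (E j) := by
  rw [T_sq]
  refine (Commute.one_left _).add_left (Commute.smul_left ?_ _)
  have h' := E_E_T h
  rw [(E_E i j).eq, mul_assoc, ← (E_T i).eq] at h'
  exact h'.symm

theorem action_T_vec {d : ℕ} {i : Fin (n - 1)} {χ : ℕ → K}
    {ρ : BT n →ₐ[K] Module.End K (SWord n →₀ K)}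
    (hρ : IsColouredAction d χ ρ) (a : SWord n) (h : a (lo i) < a (hi i)) :
    ρ (T i) (vec K a) = vec K (sw i a) := by
  rw [hρ.T, opG_vec, coefG, if_neg (by omega), zero_smul, add_zero]

/-- The element of `E_n^B` attached to a signed permutation. -/
def Tw (a : SWord n) : BT n := tau T (B n) a

theorem Tw_id : Tw (SWord.id n) = 1 := tau_id

theorem T_mul_Tw (i : Fin (n - 1)) (a : SWord n) :
    T i * Tw a = Tw (sw i a) ∨ T i * Tw a = Tw (sw i a) + (u - u⁻¹) • (E i * Tw a) := by
  rcases lt_or_gt_of_ne (a.apply_ne (lo_ne_hi i)).1 with h | h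
  · left
    have h1 := (tau_descent isBraidB (sw i a)).1 i (by rwa [sw_lo, sw_hi])
    rw [sw_sw] at h1
    exact h1.symm
  · right
    have h1 : Tw a = T i * Tw (sw i a) := (tau_descent isBraidB a).1 i h
    conv_lhs => rw [h1, ← mul_assoc, T_sq]
    rw [add_mul, one_mul, smul_mul_assoc, mul_assoc, ← h1]

theorem B_mul_Tw (a : SWord n) :
    B n * Tw a = Tw (fl a) ∨ B n * Tw a = Tw (fl a) + (v - v⁻¹) • (F 0 * Tw a) := by
  rcases lt_or_gt_of_ne (a.ne_zero 0) with h | h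
  · right
    have h1 : Tw a = B n * Tw (fl a) := (tau_descent isBraidB a).2 h
    conv_lhs => rw [h1, ← mul_assoc, B_sq]
    rw [add_mul, one_mul, smul_mul_assoc, mul_assoc, ← h1]
  · left
    have h1 := (tau_descent isBraidB (fl a)).2 (by rw [fl_zero]; omega)
    rw [fl_fl] at h1
    exact h1.symm

/-- Along a reduced expression every generator meets an ascent, or a positive first letter, so no
correction term appears, whatever the colouring. -/
theorem action_Tw {d : ℕ} {χ : ℕ → K} {ρ : BT n →ₐ[K] Module.End K (SWord n →₀ K)}
    (hρ : IsColouredAction d χ ρ) (a : SWord n) : ρ (Tw a) (vec K (SWord.id n)) = vec K a := by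
  induction hm : height a using Nat.strong_induction_on generalizing a with
  | _ m ih =>
  subst hm
  by_cases h : ∃ i, a (hi i) < a (lo i)
  · obtain ⟨i, hi⟩ := h
    rw [Tw, (tau_descent isBraidB a).1 i hi, map_mul, Module.End.mul_apply, ← Tw,
      ih _ (height_sw hi) _ rfl, action_T_vec hρ _ (by rwa [sw_lo, sw_hi]), sw_sw]
  · by_cases h0 : a 0 < 0
    · rw [Tw, (tau_descent isBraidB a).2 h0, map_mul, Module.End.mul_apply, ← Tw,
        ih _ (height_fl h0) _ rfl, hρ.B, opB_vec, coefB, if_neg, zero_smul, add_zero, fl_fl]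
      rw [fl_zero]; omega
    · push Not at h
      have h0' := a.ne_zero 0
      rw [a.eq_id (by omega) h, Tw_id, map_one, Module.End.one_apply]

end BT

/-! ### Conjugation by units -/

section Conj

variable {R : Type*} [Monoid R] {τ : Rˣ} {x y z x' y' : R}

theorem semiconjBy_conj (τ : Rˣ) (x : R) : SemiconjBy (τ : R) x (τ * x * ↑τ⁻¹) := by
  simp [SemiconjBy, mul_assoc]

theorem semiconjBy_unique (h₁ : SemiconjBy (τ : R) x y) (h₂ : SemiconjBy (τ : R) x z) : y = z :=
  (Units.mul_left_inj τ).1 (h₁.eq.symm.trans h₂.eq)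

theorem eq_conj (h : SemiconjBy (τ : R) x y) : y = τ * x * ↑τ⁻¹ :=
  semiconjBy_unique h (semiconjBy_conj τ x)

theorem commute_conj (hx : SemiconjBy (τ : R) x x') (hy : SemiconjBy (τ : R) y y')
    (h : Commute x y) : Commute x' y' :=
  semiconjBy_unique (hx.mul_right hy) (h.eq ▸ hy.mul_right hx)

theorem semiconjBy_conj_of_commute (ht : Commute z (τ : R)) (h : SemiconjBy z x y) :
    SemiconjBy z (τ * x * ↑τ⁻¹) (τ * y * ↑τ⁻¹) :=
  (SemiconjBy.mul_right ht h).mul_right (Commute.units_inv_right ht)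

theorem commute_of_semiconjBy (ht : Commute z (τ : R)) (h : SemiconjBy (τ : R) x y)
    (hy : Commute z y) : Commute z x := by
  have e := eq_conj (SemiconjBy.units_inv_symm_left h)
  rw [inv_inv] at e
  rw [e]
  exact ((Commute.units_inv_right ht).mul_right hy).mul_right ht

/-- Conjugation by `τ` exchanges `x` and `y` as soon as conjugation by its square fixes one of them.
-/
theorem semiconjBy_symm_of_sq (h : SemiconjBy (τ : R) x y)
    (hs : Commute ((τ : R) * τ) x) : SemiconjBy (τ : R) y x := by
  refine (Units.mul_left_inj τ).1 ?_
  rw [mul_assoc, ← h.eq, ← mul_assoc, hs.eq, mul_assoc]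

theorem semiconjBy_symm_of_sq' (h : SemiconjBy (τ : R) x y)
    (hs : Commute ((τ : R) * τ) y) : SemiconjBy (τ : R) y x := by
  refine (Units.mul_right_inj τ).1 ?_
  rw [← mul_assoc, hs.eq, ← mul_assoc, ← h.eq, mul_assoc]

end Conj

theorem s_val {n : ℕ} (k : Fin (n - 1)) (j : Fin n) :
    (s k j).val = if j.val = k.val then k.val + 1 else if j.val = k.val + 1 then k.val
      else j.val := by
  by_cases h1 : j = lo k
  · subst h1; rw [s_lo]; simp [lo, hi]
  · by_cases h2 : j = hi k
    · subst h2; rw [s_hi]; simp [lo, hi]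
    · rw [s_of_ne h1 h2]
      simp only [Fin.ext_iff, lo, hi] at h1 h2
      simp [h1, h2]

namespace BT

open SWord

/-! ### Ties between arbitrary positions -/

section Tie

variable {n : ℕ} [NeZero n]

variable (n) in
/-- The unit `T_k`, and `1` if `k` is out of range. -/
def Tn (k : ℕ) : (BT n)ˣ := if h : k < n - 1 then Tu ⟨k, h⟩ else 1

/-- The element `E_k`, and `1` if `k` is out of range. -/
def En (k : ℕ) : BT n := if h : k < n - 1 then E ⟨k, h⟩ else 1

theorem Tn_of_lt {k : ℕ} (h : k < n - 1) : (Tn n k : BT n) = T ⟨k, h⟩ := by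
  rw [Tn, dif_pos h, Tu_val]

theorem En_of_lt {k : ℕ} (h : k < n - 1) : (En k : BT n) = E ⟨k, h⟩ := dif_pos h

theorem Tn_of_not_lt {k : ℕ} (h : ¬k < n - 1) : (Tn n k : BT n) = 1 := by
  rw [Tn, dif_neg h, Units.val_one]

theorem En_of_not_lt {k : ℕ} (h : ¬k < n - 1) : (En k : BT n) = 1 := dif_neg h

theorem Tn_far {k l : ℕ} (h : k + 1 < l ∨ l + 1 < k) : Commute (Tn n k : BT n) (Tn n l) := by
  by_cases hk : k < n - 1
  · by_cases hl : l < n - 1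
    · rw [Tn_of_lt hk, Tn_of_lt hl]
      exact isBraidB.far _ _ h
    · rw [Tn_of_not_lt hl]; exact Commute.one_right _
  · rw [Tn_of_not_lt hk]; exact Commute.one_left _

theorem En_Tn_far {k l : ℕ} (h : k + 1 < l ∨ l + 1 < k) : Commute (En k : BT n) (Tn n l) := by
  by_cases hk : k < n - 1
  · by_cases hl : l < n - 1
    · rw [En_of_lt hk, Tn_of_lt hl]
      exact E_T_far h
    · rw [Tn_of_not_lt hl]; exact Commute.one_right _
  · rw [En_of_not_lt hk]; exact Commute.one_left _

theorem En_En (k l : ℕ) : Commute (En k : BT n) (En l) := by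
  by_cases hk : k < n - 1
  · by_cases hl : l < n - 1
    · rw [En_of_lt hk, En_of_lt hl]
      exact E_E _ _
    · rw [En_of_not_lt hl]; exact Commute.one_right _
  · rw [En_of_not_lt hk]; exact Commute.one_left _

theorem En_Tn (k : ℕ) : Commute (En k : BT n) (Tn n k) := by
  by_cases hk : k < n - 1
  · rw [En_of_lt hk, Tn_of_lt hk]
    exact E_T _
  · rw [En_of_not_lt hk]; exact Commute.one_left _

theorem Tn_sq_En {k l : ℕ} (h : k + 1 = l ∨ l + 1 = k) :
    Commute ((Tn n k : BT n) * Tn n k) (En l) := by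
  by_cases hk : k < n - 1
  · by_cases hl : l < n - 1
    · rw [En_of_lt hl, Tn_of_lt hk]
      exact T_T_E h
    · rw [En_of_not_lt hl]; exact Commute.one_right _
  · rw [Tn_of_not_lt hk, one_mul]; exact Commute.one_left _

/-- The tie between the positions `i` and `i + m + 1`. -/
def gap (i : ℕ) : ℕ → BT n
  | 0 => En i
  | m + 1 => Tn n (i + m + 1) * gap i m * ↑(Tn n (i + m + 1))⁻¹

theorem gap_succ (i m : ℕ) :
    SemiconjBy (Tn n (i + m + 1) : BT n) (gap i m) (gap i (m + 1)) :=
  semiconjBy_conj _ _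

theorem commute_gap {x : BT n} {i : ℕ} (h₀ : Commute x (En i)) (m : ℕ)
    (h : ∀ l, i < l → l ≤ i + m → Commute x (Tn n l)) : Commute x (gap i m) := by
  induction m with
  | zero => exact h₀
  | succ m ih =>
    exact semiconjBy_conj_of_commute (h _ (by omega) (by omega))
      (ih fun l h1 h2 => h l h1 (by omega))

theorem Tn_gap_far {k i m : ℕ} (h : k + 1 < i ∨ i + m + 1 < k) :
    Commute (Tn n k : BT n) (gap i m) :=
  commute_gap (En_Tn_far (by omega)).symm m fun l _ _ => Tn_far (by omega)

/-- If `T_k` is far from the last conjugating factor, induct. Otherwise the tie is a shorter one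
conjugated by `T_{k+1} T_k`; the braid relation moves `T_k` through this product into `T_{k+1}`,
which commutes with the shorter tie. -/
theorem Tn_gap_between {k i m : ℕ} (h₁ : i < k) (h₂ : k < i + m) (hn : i + m < n - 1) :
    Commute (Tn n k : BT n) (gap i m) := by
  induction m with
  | zero => omega
  | succ m ih =>
    rcases (by omega : k < i + m ∨ k = i + m) with h | h
    · exact semiconjBy_conj_of_commute (Tn_far (by omega)) (ih h (by omega))
    · obtain ⟨m, rfl⟩ : ∃ m', m = m' + 1 := ⟨m - 1, by omega⟩
      have hb : (Tn n k : BT n) * Tn n (k + 1) * Tn n k = Tn n (k + 1) * Tn n k * Tn n (k + 1) := by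
        rw [Tn_of_lt (by omega), Tn_of_lt (by omega)]
        exact isBraidB.braid _ _ rfl
      have e1 := gap_succ (n := n) i m
      have e2 := gap_succ (n := n) i (m + 1)
      have e3 : Commute (Tn n (k + 1) : BT n) (gap i m) := Tn_gap_far (by omega)
      rw [show i + m + 1 = k by omega] at e1
      rw [show i + (m + 1) + 1 = k + 1 by omega] at e2
      have e4 := e2.mul_left e1
      have e5 := e4.mul_left e3
      have e6 : SemiconjBy (((Tn n (k + 1) * Tn n k : (BT n)ˣ) : BT n) * Tn n (k + 1)) (gap i m)
          (gap i (m + 1 + 1)) := by simpa using e5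
      have e7 : SemiconjBy ((Tn n (k + 1) * Tn n k : (BT n)ˣ) : BT n) (gap i m)
          (gap i (m + 1 + 1)) := by simpa using e4
      have hb' : (Tn n k : BT n) * ((Tn n (k + 1) * Tn n k : (BT n)ˣ) : BT n) =
          ((Tn n (k + 1) * Tn n k : (BT n)ˣ) : BT n) * Tn n (k + 1) := by
        simpa [mul_assoc] using hb
      refine (Units.mul_left_inj (Tn n (k + 1) * Tn n k)).1 ?_
      rw [mul_assoc, ← e7.eq, ← mul_assoc, hb', e6.eq, ← hb', mul_assoc]

/-- Ties are built by moving the right end; this shows that the left end can be moved as well. The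
base case is the relation between `E_i T_j T_i` and `T_j T_i E_j`, and the later conjugating factors
are far from `T_i`. -/
theorem Tn_gap_lo {i m : ℕ} (hn : i + m + 1 < n - 1) :
    SemiconjBy (Tn n i : BT n) (gap i (m + 1)) (gap (i + 1) m) := by
  induction m with
  | zero =>
    refine (Units.mul_left_inj (Tn n (i + 1))).1 ?_
    have h1 := (gap_succ (n := n) i 0).eq
    have h2 : (En (i + 1) : BT n) * (Tn n i : BT n) * (Tn n (i + 1) : BT n) =
        (Tn n i : BT n) * (Tn n (i + 1) : BT n) * En i := by
      rw [Tn_of_lt (by omega), Tn_of_lt (by omega), En_of_lt (by omega), En_of_lt (by omega)]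
      exact E_T_T (.inr rfl)
    rw [mul_assoc, ← h1, ← mul_assoc]
    exact h2.symm
  | succ m ih =>
    have h := semiconjBy_conj_of_commute (Tn_far (n := n) (k := i) (l := i + (m + 1) + 1)
      (by omega)) (ih (by omega))
    have e : (gap (i + 1) (m + 1) : BT n) =
        (Tn n (i + (m + 1) + 1) : BT n) * gap (i + 1) m *
          (↑(Tn n (i + (m + 1) + 1))⁻¹ : BT n) := by
      rw [gap.eq_2, show i + 1 + m + 1 = i + (m + 1) + 1 by omega]
    rw [e]
    exact h

/-- Shorten the tie from the left by `T_i`, which is far from the square, until only some `E`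
adjacent to it remains. -/
theorem Tn_sq_gap_right {i m : ℕ} (hn : i + m + 1 < n - 1) :
    Commute ((Tn n (i + m + 1) : BT n) * Tn n (i + m + 1)) (gap i m) := by
  induction m generalizing i with
  | zero => exact Tn_sq_En (.inr rfl)
  | succ m ih =>
    have h := ih (i := i + 1) (by omega)
    rw [show i + 1 + m + 1 = i + (m + 1) + 1 by omega] at h
    have h' : Commute (Tn n (i + (m + 1) + 1) : BT n) (Tn n i) := Tn_far (by omega)
    exact commute_of_semiconjBy (h'.mul_left h') (Tn_gap_lo (by omega)) h

theorem Tn_gap_hi {i m : ℕ} (hn : i + m + 1 < n - 1) :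
    SemiconjBy (Tn n (i + m + 1) : BT n) (gap i (m + 1)) (gap i m) :=
  semiconjBy_symm_of_sq (gap_succ i m) (Tn_sq_gap_right hn)

theorem Tn_gap_pred {i m : ℕ} (hn : i + m + 1 < n - 1) :
    SemiconjBy (Tn n i : BT n) (gap (i + 1) m) (gap i (m + 1)) :=
  semiconjBy_symm_of_sq' (Tn_gap_lo hn) (commute_gap (Tn_sq_En (.inl rfl)) m fun l _ _ =>
    have h : Commute (Tn n i : BT n) (Tn n l) := Tn_far (by omega)
    h.mul_left h)

/-- The tie between two positions. -/
def tie (a b : Fin n) : BT n :=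
  if a < b then gap a (b - a - 1) else if b < a then gap b (a - b - 1) else 1

theorem tie_comm (a b : Fin n) : tie a b = tie b a := by
  unfold tie
  split_ifs with h1 h2
  · exact (lt_asymm h1 h2).elim
  all_goals rfl

theorem tie_self (a : Fin n) : tie a a = 1 := by simp [tie]

theorem tie_eq {a b : Fin n} {i m : ℕ} (ha : a.val = i) (hb : b.val = i + m + 1) :
    tie a b = gap i m := by
  have h : a < b := by rw [Fin.lt_def]; omega
  rw [tie, if_pos h, ha, show b.val - i - 1 = m by omega]

theorem tie_eq' {a b : Fin n} {i m : ℕ} (ha : a.val = i) (hb : b.val = i + m + 1) :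
    tie b a = gap i m := by
  rw [tie_comm, tie_eq ha hb]

theorem tie_lo_hi (i : Fin (n - 1)) : tie (lo i) (hi i) = (E i : BT n) := by
  rw [tie_eq (a := lo i) (b := hi i) (i := i.val) (m := 0) rfl rfl, gap, En_of_lt i.2]

/-- The ties transform under `T_k` as pairs of positions under `s k`. The cases are the relative
positions of `{k, k + 1}` and the two ends. -/
theorem T_tie (k : Fin (n - 1)) (a b : Fin n) :
    SemiconjBy (T k) (tie a b) (tie (s k a) (s k b)) := by
  have key : ∀ a b : Fin n, a < b → SemiconjBy (T k) (tie a b) (tie (s k a) (s k b)) := by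
    intro a b h
    rw [Fin.lt_def] at h
    obtain ⟨m, hm⟩ : ∃ m, b.val = a.val + m + 1 := ⟨b.val - a.val - 1, by omega⟩
    have hb := b.2
    have hk := k.2
    have hT : T k = (Tn n k.val : BT n) := (Tn_of_lt k.2).symm
    rw [hT, tie_eq rfl hm]
    have sa := s_val k a
    have sb := s_val k b
    rcases (by omega : k.val + 1 < a.val ∨ b.val < k.val ∨ k.val + 1 = a.val ∨
      (k.val = a.val ∧ m = 0) ∨ (k.val = a.val ∧ 0 < m) ∨
      (a.val < k.val ∧ k.val + 1 < b.val) ∨ (a.val < k.val ∧ k.val + 1 = b.val) ∨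
      k.val = b.val) with h | h | h | ⟨h, h'⟩ | ⟨h, h'⟩ | ⟨h, h'⟩ | ⟨h, h'⟩ | h
    · rw [tie_eq (i := a.val) (m := m) (by split_ifs at sa <;> omega)
        (by split_ifs at sb <;> omega)]
      exact Tn_gap_far (by omega)
    · rw [tie_eq (i := a.val) (m := m) (by split_ifs at sa <;> omega)
        (by split_ifs at sb <;> omega)]
      exact Tn_gap_far (by omega)
    · rw [tie_eq (i := k.val) (m := m + 1) (by split_ifs at sa <;> omega)
        (by split_ifs at sb <;> omega), ← h]
      exact Tn_gap_pred (by omega)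
    · rw [tie_eq' (i := k.val) (m := 0) (by split_ifs at sb <;> omega)
        (by split_ifs at sa <;> omega), ← h, h']
      exact (En_Tn _).symm
    · obtain ⟨m, rfl⟩ : ∃ m', m = m' + 1 := ⟨m - 1, by omega⟩
      rw [tie_eq (i := k.val + 1) (m := m) (by split_ifs at sa <;> omega)
        (by split_ifs at sb <;> omega), ← h]
      exact Tn_gap_lo (by omega)
    · rw [tie_eq (i := a.val) (m := m) (by split_ifs at sa <;> omega)
        (by split_ifs at sb <;> omega)]
      exact Tn_gap_between h (by omega) (by omega)
    · obtain ⟨m, rfl⟩ : ∃ m', m = m' + 1 := ⟨m - 1, by omega⟩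
      rw [tie_eq (i := a.val) (m := m) (by split_ifs at sa <;> omega)
        (by split_ifs at sb <;> omega), show k.val = a.val + m + 1 by omega]
      exact Tn_gap_hi (by omega)
    · rw [tie_eq (i := a.val) (m := m + 1) (by split_ifs at sa <;> omega)
        (by split_ifs at sb <;> omega), show k.val = a.val + m + 1 by omega]
      exact gap_succ _ _
  rcases lt_trichotomy a b with h | h | h
  · exact key a b h
  · rw [h, tie_self, tie_self]; exact SemiconjBy.one_right _
  · rw [tie_comm a, tie_comm (s k a)]; exact key b a h

end Tie

end BT

namespace BT

open SWord

/-! ### Relations between ties -/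

section Bond

variable {n : ℕ} [NeZero n]

theorem closure_s : Submonoid.closure (Set.range (s (n := n))) = ⊤ := by
  obtain ⟨m, rfl⟩ : ∃ m, n = m + 1 := ⟨n - 1, by have := NeZero.pos n; omega⟩
  exact Equiv.Perm.mclosure_swap_castSucc_succ m

/-- Every permutation of the positions is realized by conjugation with a unit. -/
theorem exists_unit_conj (σ : Equiv.Perm (Fin n)) : ∃ τ : (BT n)ˣ,
    (∀ a b, SemiconjBy (τ : BT n) (tie a b) (tie (σ a) (σ b))) ∧
      ∀ a, SemiconjBy (τ : BT n) (F a) (F (σ a)) := by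
  have hσ : σ ∈ Submonoid.closure (Set.range (s (n := n))) := by
    rw [closure_s]; exact Submonoid.mem_top σ
  induction hσ using Submonoid.closure_induction with
  | mem σ h =>
    obtain ⟨k, rfl⟩ := h
    exact ⟨Tu k, T_tie k, T_F k⟩
  | one => exact ⟨1, fun a b => SemiconjBy.one_left _, fun a => SemiconjBy.one_left _⟩
  | mul σ σ' _ _ h h' =>
    obtain ⟨τ, h1, h2⟩ := h
    obtain ⟨τ', h1', h2'⟩ := h'
    refine ⟨τ * τ', fun a b => ?_, fun a => ?_⟩
    · rw [Units.val_mul]; exact (h1 _ _).mul_left (h1' a b)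
    · rw [Units.val_mul]; exact (h2 _).mul_left (h2' a)

theorem exists_perm {m : ℕ} {x y a b : Fin m} (hxy : x ≠ y) (hab : a ≠ b) :
    ∃ σ : Equiv.Perm (Fin m), σ x = a ∧ σ y = b := by
  have hb : x ≠ Equiv.swap x a b := fun h => hab <| (Equiv.swap x a).injective <| by
    rw [Equiv.swap_apply_right]; exact h
  refine ⟨Equiv.swap x a * Equiv.swap y (Equiv.swap x a b), ?_, ?_⟩
  · rw [Equiv.Perm.mul_apply, Equiv.swap_apply_of_ne_of_ne hxy hb, Equiv.swap_apply_left]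
  · rw [Equiv.Perm.mul_apply, Equiv.swap_apply_left, Equiv.swap_apply_self]

/-- Any two distinct positions are conjugate to the first two positions. -/
theorem exists_conj_first {a b : Fin n} (hab : a ≠ b) : ∃ (k : Fin (n - 1)) (τ : (BT n)ˣ)
    (σ : Equiv.Perm (Fin n)), k.val = 0 ∧ σ (lo k) = a ∧ σ (hi k) = b ∧
    (∀ x y, SemiconjBy (τ : BT n) (tie x y) (tie (σ x) (σ y))) ∧
      ∀ x, SemiconjBy (τ : BT n) (F x) (F (σ x)) := by
  have hn : 0 < n - 1 := by
    have h1 := a.2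
    have h2 := b.2
    have h3 := Fin.val_ne_of_ne hab
    omega
  obtain ⟨σ, h1, h2⟩ := exists_perm (lo_ne_hi ⟨0, hn⟩) hab
  obtain ⟨τ, h3, h4⟩ := exists_unit_conj σ
  exact ⟨⟨0, hn⟩, τ, σ, rfl, h1, h2, h3, h4⟩

/-- The first pair of positions is the convenient one: a tie starting to the right of `0` involves
only some `E_i` and factors `T_l` with `l ≥ 2`, which commute with `E_0`. A longer tie starting at
`0` is moved there by `T_0`, which also commutes with `E_0`. -/
theorem En_zero_gap {i m : ℕ} (hn : i + m < n - 1) : Commute (En 0 : BT n) (gap i m) := by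
  have h : ∀ i m : ℕ, 0 < i → Commute (En 0 : BT n) (gap i m) := fun i m hi =>
    commute_gap (En_En 0 i) m fun l h1 _ => En_Tn_far (by omega)
  rcases Nat.eq_zero_or_pos i with rfl | hi
  · cases m with
    | zero => exact Commute.refl _
    | succ m => exact commute_of_semiconjBy (En_Tn 0) (Tn_gap_lo (by omega)) (h 1 m one_pos)
  · exact h i m hi

theorem E_tie {k : Fin (n - 1)} (hk : k.val = 0) (c d : Fin n) : Commute (E k) (tie c d) := by
  have hE : E k = (En 0 : BT n) := by rw [← hk, En_of_lt k.2]
  have key : ∀ c d : Fin n, c < d → Commute (E k) (tie c d) := fun c d h => by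
    rw [Fin.lt_def] at h
    rw [hE, tie_eq (i := c.val) (m := d.val - c.val - 1) rfl (by omega)]
    exact En_zero_gap (by omega)
  rcases lt_trichotomy c d with h | h | h
  · exact key c d h
  · rw [h, tie_self]; exact Commute.one_right _
  · rw [tie_comm]; exact key d c h

theorem tie_tie (a b c d : Fin n) : Commute (tie a b) (tie c d) := by
  by_cases hab : a = b
  · rw [hab, tie_self]; exact Commute.one_left _
  · obtain ⟨k, τ, σ, hk, rfl, rfl, h1, -⟩ := exists_conj_first hab
    have h2 := h1 (σ.symm c) (σ.symm d)
    rw [σ.apply_symm_apply, σ.apply_symm_apply] at h2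
    refine commute_conj (h1 _ _) h2 ?_
    rw [tie_lo_hi]
    exact E_tie hk _ _

theorem F_tie (a b c : Fin n) : Commute (F c) (tie a b) := by
  by_cases hab : a = b
  · rw [hab, tie_self]; exact Commute.one_right _
  · obtain ⟨k, τ, σ, hk, rfl, rfl, h1, h2⟩ := exists_conj_first hab
    have h3 := h2 (σ.symm c)
    rw [σ.apply_symm_apply] at h3
    refine commute_conj h3 (h1 _ _) ?_
    rw [tie_lo_hi]
    exact F_E _ _

/-- Commutation of the `F_j` is not a defining relation. For adjacent positions, conjugating `E_i
F_i = F_i F_{i+1}` by `T_i` gives `E_i F_{i+1} = F_{i+1} F_i`, while the left side is also `F_i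
F_{i+1}`. -/
theorem F_F (a b : Fin n) : Commute (F a) (F b) := by
  by_cases hab : a = b
  · rw [hab]
  · obtain ⟨k, τ, σ, hk, rfl, rfl, -, h2⟩ := exists_conj_first hab
    refine commute_conj (h2 _) (h2 _) ?_
    have h3 := T_F k (lo k)
    have h4 := T_F k (hi k)
    have h5 : SemiconjBy (T k) (E k) (E k) := (E_T k).symm
    rw [s_lo] at h3
    rw [s_hi] at h4
    have e1 := h5.mul_right h3
    have e2 := h3.mul_right h4
    rw [E_F_lo] at e1
    exact (E_F_hi k).trans (semiconjBy_unique (τ := Tu k) e1 e2)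

theorem F_mul_tie (a b : Fin n) : F a * tie a b = F a * F b := by
  by_cases hab : a = b
  · rw [hab, tie_self, mul_one, F_sq]
  · obtain ⟨k, τ, σ, hk, rfl, rfl, h1, h2⟩ := exists_conj_first hab
    have e1 := (h2 (lo k)).mul_right (h1 (lo k) (hi k))
    have e2 := (h2 (lo k)).mul_right (h2 (hi k))
    rw [tie_lo_hi, (F_E _ _).eq, E_F_lo] at e1
    exact semiconjBy_unique e1 e2

/-- Transitivity for the positions `0`, `1` and `m + 2`. The base case is the relation `E_j T_i E_j
= E_i E_j T_i` multiplied by the inverse of `T_i`; further conjugating factors commute with `E_0`.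
-/
theorem En_mul_gap (m : ℕ) (hm : m + 1 < n - 1) :
    (En 0 : BT n) * gap 1 m = En 0 * gap 0 (m + 1) := by
  induction m with
  | zero =>
    have h : Near (⟨1, by omega⟩ : Fin (n - 1)) ⟨0, by omega⟩ := .inr rfl
    have h1 := E_E_T h
    rw [T_E_E h, ← Tn_of_lt, ← En_of_lt, ← En_of_lt] at h1
    change (En 0 : BT n) * En 1 = En 0 * ((Tn n 1 : BT n) * En 0 * (↑(Tn n 1)⁻¹ : BT n))
    rw [← mul_assoc, ← mul_assoc, ← h1, Units.mul_inv_cancel_right, (En_En 0 1).eq]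
  | succ m ih =>
    have h : ∀ x : BT n, En 0 * ((Tn n (m + 2) : BT n) * x * (↑(Tn n (m + 2))⁻¹ : BT n)) =
        (Tn n (m + 2) : BT n) * (En 0 * x) * (↑(Tn n (m + 2))⁻¹ : BT n) := fun x => by
      have h1 : Commute (En 0 : BT n) (Tn n (m + 2)) := En_Tn_far (by omega)
      rw [← mul_assoc, ← mul_assoc, h1.eq, mul_assoc (Tn n (m + 2) : BT n)]
    have e1 : (gap 1 (m + 1) : BT n) =
        (Tn n (m + 2) : BT n) * gap 1 m * (↑(Tn n (m + 2))⁻¹ : BT n) := by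
      rw [gap.eq_2, show 1 + m + 1 = m + 2 by omega]
    have e2 : (gap 0 (m + 1 + 1) : BT n) =
        (Tn n (m + 2) : BT n) * gap 0 (m + 1) * (↑(Tn n (m + 2))⁻¹ : BT n) := by
      rw [gap.eq_2, show 0 + (m + 1) + 1 = m + 2 by omega]
    rw [e1, e2, h, h, ih (by omega)]

theorem tie_sq (a b : Fin n) : tie a b * tie a b = tie a b := by
  by_cases hab : a = b
  · rw [hab, tie_self, mul_one]
  · obtain ⟨k, τ, σ, hk, rfl, rfl, h1, h2⟩ := exists_conj_first hab
    have e1 := (h1 (lo k) (hi k)).mul_right (h1 (lo k) (hi k))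
    have e2 := h1 (lo k) (hi k)
    rw [tie_lo_hi, E_sq] at e1
    rw [tie_lo_hi] at e2
    exact semiconjBy_unique e1 e2

theorem tie_mul_tie (a b c : Fin n) : tie a b * tie b c = tie a b * tie a c := by
  by_cases hab : a = b
  · rw [hab]
  by_cases hbc : b = c
  · rw [hbc, tie_self, mul_one, tie_sq]
  by_cases hac : a = c
  · rw [hac, tie_self, mul_one, tie_comm b c, tie_sq]
  obtain ⟨k, τ, σ, hk, rfl, rfl, h1, h2⟩ := exists_conj_first hab
  obtain ⟨c, rfl⟩ := σ.surjective c
  have e1 := (h1 (lo k) (hi k)).mul_right (h1 (hi k) c)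
  have e2 := (h1 (lo k) (hi k)).mul_right (h1 (lo k) c)
  have hc1 : c ≠ lo k := fun h => hac (congrArg σ h.symm)
  have hc2 : c ≠ hi k := fun h => hbc (congrArg σ h.symm)
  simp only [ne_eq, Fin.ext_iff, lo, hi] at hc1 hc2
  have hc := c.2
  have h3 : tie (lo k) (hi k) * tie (hi k) c = tie (lo k) (hi k) * tie (lo k) c := by
    rw [tie_eq (a := hi k) (i := 1) (m := c.val - 2) (by simp [hi, hk]) (by omega),
      tie_eq (a := lo k) (b := c) (i := 0) (m := c.val - 2 + 1) (by simp [lo, hk]) (by omega),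
      tie_eq (a := lo k) (b := hi k) (i := 0) (m := 0) (by simp [lo, hk]) (by simp [hi, hk])]
    exact En_mul_gap _ (by omega)
  rw [h3] at e1
  exact semiconjBy_unique e1 e2

/-- Building ties by moving the right end uses only `T_l` with `l` beyond the left end. Hence `T_0`,
the one generator `T_l` not assumed to commute with `B`, never occurs. -/
theorem B_tie (a b : Fin n) : Commute (B n) (tie a b) := by
  have key : ∀ a b : Fin n, a < b → Commute (B n) (tie a b) := fun a b h => by
    rw [Fin.lt_def] at h
    rw [tie_eq (i := a.val) (m := b.val - a.val - 1) rfl (by omega)]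
    refine commute_gap ?_ _ fun l h1 h2 => ?_
    · rw [En_of_lt (by omega)]; exact B_E _
    · rw [Tn_of_lt (by omega)]; exact isBraidB.B_T _ (Nat.ne_of_gt (by simp; omega))
  rcases lt_trichotomy a b with h | h | h
  · exact key a b h
  · rw [h, tie_self]; exact Commute.one_right _
  · rw [tie_comm]; exact key b a h

/-- The tie between two elements of `{0, 1, …, n}`; a tie with `0` is some `F_j`. -/
def bond : Option (Fin n) × Option (Fin n) → BT n
  | (none, none) => 1
  | (none, some j) => F j
  | (some j, none) => F j
  | (some i, some j) => tie i j

theorem bond_self (x : Option (Fin n)) : bond (x, x) = 1 := by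
  cases x with
  | none => rfl
  | some a => exact tie_self a

theorem bond_comm (x y : Option (Fin n)) : bond (x, y) = bond (y, x) := by
  cases x <;> cases y
  · rfl
  · rfl
  · rfl
  · exact tie_comm _ _

theorem bond_bond (p q : Option (Fin n) × Option (Fin n)) : Commute (bond p) (bond q) := by
  rcases p with ⟨_ | a, _ | b⟩ <;> rcases q with ⟨_ | c, _ | d⟩ <;> simp only [bond] <;>
    first
    | exact Commute.one_left _
    | exact Commute.one_right _
    | exact F_F _ _
    | exact F_tie _ _ _
    | exact (F_tie _ _ _).symm
    | exact tie_tie _ _ _ _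

/-- Transitivity with the position `0` included. -/
theorem bond_mul_bond (x y z : Option (Fin n)) :
    bond (x, y) * bond (y, z) = bond (x, y) * bond (x, z) := by
  rcases x with _ | a <;> rcases y with _ | b <;> rcases z with _ | c <;>
    simp only [bond, F_sq, mul_one, F_mul_tie, tie_mul_tie]
  · rw [tie_comm, (F_tie _ _ _).symm.eq, (F_tie _ _ _).symm.eq, F_mul_tie, tie_comm, F_mul_tie,
      (F_F _ _).eq]

theorem bond_sq (p : Option (Fin n) × Option (Fin n)) : bond p * bond p = bond p := by
  obtain ⟨x, y⟩ := p
  have h := bond_mul_bond x y x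
  rwa [bond_comm y x, bond_self, mul_one] at h

theorem T_bond (k : Fin (n - 1)) (x y : Option (Fin n)) :
    SemiconjBy (T k) (bond (x, y)) (bond (x.map (s k), y.map (s k))) := by
  rcases x with _ | a <;> rcases y with _ | b
  · exact SemiconjBy.one_right _
  · exact T_F _ _
  · exact T_F _ _
  · exact T_tie _ _ _

theorem B_bond (p : Option (Fin n) × Option (Fin n)) : Commute (B n) (bond p) := by
  rcases p with ⟨_ | a, _ | b⟩
  · exact Commute.one_right _
  · exact B_F _
  · exact B_F _
  · exact B_tie _ _

end Bond

end BT

/-! ### Polynomials in commuting idempotents -/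

section Idempotents

variable {k R ι : Type*} [Field k] [Ring R] [Algebra k R] {P : ι → R}

/-- Evaluation of polynomials at a family of commuting elements. -/
def commAeval (k : Type*) [Field k] [Algebra k R] (P : ι → R) (hP : ∀ i j, Commute (P i) (P j)) :
    MvPolynomial ι k →ₐ[k] R :=
  letI : CommRing (Algebra.adjoin k (Set.range P)) :=
    { (inferInstance : Ring (Algebra.adjoin k (Set.range P))) with
      mul_comm := (Algebra.isMulCommutative_adjoin k (by
        rintro _ ⟨i, rfl⟩ _ ⟨j, rfl⟩
        exact hP i j)).is_comm.comm }
  (Algebra.adjoin k (Set.range P)).val.comp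
    (MvPolynomial.aeval fun i => ⟨P i, Algebra.subset_adjoin ⟨i, rfl⟩⟩)

theorem commAeval_X (hP : ∀ i j, Commute (P i) (P j)) (i : ι) :
    commAeval k P hP (MvPolynomial.X i) = P i := by
  simp [commAeval]

variable [Fintype ι] [DecidableEq ι]

/-- The polynomial of the joint eigenspace where exactly the idempotents in `S` act as `1`. -/
def eigenPoly (k : Type*) [Field k] (S : Finset ι) : MvPolynomial ι k :=
  (∏ i ∈ S, MvPolynomial.X i) * ∏ i ∈ Finset.univ \ S, (1 - MvPolynomial.X i)

/-- Expand the product of the factors `X i + (1 - X i) = 1`. -/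
theorem sum_eigenPoly : ∑ S : Finset ι, eigenPoly k S = 1 := by
  have h := Finset.prod_add (fun i : ι => (MvPolynomial.X i : MvPolynomial ι k))
    (fun i => 1 - MvPolynomial.X i) Finset.univ
  simp only [add_sub_cancel, Finset.prod_const_one, Finset.powerset_univ] at h
  exact h.symm

theorem mul_commAeval_eigenPoly (hP : ∀ i j, Commute (P i) (P j)) (hs : ∀ i, P i * P i = P i)
    (S : Finset ι) (i : ι) : P i * commAeval k P hP (eigenPoly k S) =
      if i ∈ S then commAeval k P hP (eigenPoly k S) else 0 := by
  split_ifs with h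
  · rw [eigenPoly, ← Finset.mul_prod_erase S _ h, mul_assoc, map_mul, commAeval_X, ← mul_assoc, hs]
  · have h' : i ∈ Finset.univ \ S := by simp [h]
    rw [eigenPoly, ← Finset.mul_prod_erase _ _ h', mul_left_comm, map_mul, map_sub, map_one,
      commAeval_X, ← mul_assoc, mul_sub, mul_one, hs, sub_self, zero_mul]

theorem commAeval_mul_eigenPoly (hP : ∀ i j, Commute (P i) (P j)) (hs : ∀ i, P i * P i = P i)
    (S : Finset ι) (q : MvPolynomial ι k) :
    commAeval k P hP q * commAeval k P hP (eigenPoly k S) =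
      MvPolynomial.eval (fun i => if i ∈ S then 1 else 0) q • commAeval k P hP (eigenPoly k S) := by
  induction q using MvPolynomial.induction_on with
  | C a => rw [MvPolynomial.eval_C, ← MvPolynomial.algebraMap_eq, AlgHom.commutes,
      ← Algebra.smul_def]
  | add p q hp hq => rw [map_add, add_mul, hp, hq, map_add, add_smul]
  | mul_X q i hq =>
    rw [map_mul, commAeval_X, mul_assoc, mul_commAeval_eigenPoly hP hs, map_mul,
      MvPolynomial.eval_X]
    split_ifs
    · rw [hq, mul_one]
    · rw [mul_zero, mul_zero, zero_smul]

/-- On the joint eigenspace indexed by `S` the polynomial acts by its value at the indicator of `S`,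
so only the nonzero eigenspaces impose conditions. -/
theorem commAeval_eq_zero (hP : ∀ i j, Commute (P i) (P j)) (hs : ∀ i, P i * P i = P i)
    {q : MvPolynomial ι k} (hq : ∀ S : Finset ι, commAeval k P hP (eigenPoly k S) ≠ 0 →
      MvPolynomial.eval (fun i => if i ∈ S then 1 else 0) q = 0) : commAeval k P hP q = 0 := by
  rw [← mul_one q, ← sum_eigenPoly, Finset.mul_sum, map_sum]
  refine Finset.sum_eq_zero fun S _ => ?_
  rw [map_mul, commAeval_mul_eigenPoly hP hs]
  by_cases h : commAeval k P hP (eigenPoly k S) = 0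
  · rw [h, smul_zero]
  · rw [hq S h, zero_smul]

end Idempotents

theorem injective_of_map_eq_zero {k A A' : Type*} [Field k] [Ring A] [Ring A'] [Algebra k A]
    [Algebra k A'] (φ : A →ₐ[k] A') (h : ∀ x, φ x = 0 → x = 0) : Function.Injective φ :=
  (injective_iff_map_eq_zero φ).2 h

/-! ### Colourings by roots of unity -/

/-- This is where `n + 1 ≤ d` enters: a relation on `n + 1` points has at most `d` classes, and the
field contains `d` distinct `d`-th roots of unity. -/
theorem exists_colouring {n d : ℕ} (hd : n + 1 ≤ d) (r : Setoid (Option (Fin n))) :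
    ∃ c : Option (Fin n) → K, c none = 1 ∧ (∀ x, c x ^ d = 1) ∧ ∀ x y, c x = c y ↔ r x y := by
  classical
  have hd0 : d ≠ 0 := by omega
  have : NeZero d := ⟨hd0⟩
  have hζ : IsPrimitiveRoot (algebraMap ℂ K (Complex.exp (2 * Real.pi * Complex.I / d))) d :=
    (Complex.isPrimitiveRoot_exp d hd0).map_of_injective (algebraMap ℂ K).injective
  have : Finite (rootsOfUnity d K) := Nat.finite_of_card_ne_zero (by rwa [hζ.card_rootsOfUnity])
  have := Fintype.ofFinite (rootsOfUnity d K)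
  have hcard : Fintype.card (Quotient r) ≤ Fintype.card (rootsOfUnity d K) := by
    rw [← Nat.card_eq_fintype_card (α := rootsOfUnity d K), hζ.card_rootsOfUnity]
    refine (Fintype.card_quotient_le r).trans ?_
    simpa using hd
  obtain ⟨f⟩ := Function.Embedding.nonempty_of_card_le hcard
  -- Dividing by the root assigned to the class of `none` normalizes its colour to `1` without
  -- changing which colours agree.
  refine ⟨fun x => ((f ⟦x⟧ * (f ⟦none⟧)⁻¹ : rootsOfUnity d K) : Kˣ), ?_, fun x => ?_, fun x y => ?_⟩
  · simp
  · rw [← Units.val_pow_eq_pow_val, (mem_rootsOfUnity d _).1 (f ⟦x⟧ * (f ⟦none⟧)⁻¹).2,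
      Units.val_one]
  · rw [Units.val_inj, Subtype.val_inj, mul_left_inj, f.injective.eq_iff, Quotient.eq]

namespace BT

open SWord

/-! ### Spanning by products of tie polynomials and standard elements -/

section Spanning

variable {n : ℕ} [NeZero n]

/-- Polynomials in the ties. -/
def tiePoly : MvPolynomial (Option (Fin n) × Option (Fin n)) K →ₐ[K] BT n :=
  commAeval K bond bond_bond

theorem tiePoly_X (p : Option (Fin n) × Option (Fin n)) :
    tiePoly (MvPolynomial.X p) = bond p := commAeval_X _ _

/-- For a nonzero joint eigenprojection, membership of a pair in `S` means that the corresponding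
tie fixes it. The relations on ties then make `S` an equivalence relation, which some colouring
realizes. -/
theorem tiePoly_eq_zero {d : ℕ} (hd : n + 1 ≤ d)
    {q : MvPolynomial (Option (Fin n) × Option (Fin n)) K}
    (hq : ∀ c : Option (Fin n) → K, c none = 1 → (∀ x, c x ^ d = 1) →
      MvPolynomial.eval (fun p => delta (c p.1) (c p.2)) q = 0) : tiePoly q = 0 := by
  classical
  refine commAeval_eq_zero _ bond_sq fun S hS => ?_
  have key := mul_commAeval_eigenPoly (k := K) (P := bond (n := n)) bond_bond bond_sq S
  have hmem : ∀ p, p ∈ S ↔ bond p * commAeval K bond bond_bond (eigenPoly K S) =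
      commAeval K bond bond_bond (eigenPoly K S) := fun p => by
    rw [key]
    split_ifs with h
    · simp [h]
    · simp [h, Ne.symm hS]
  let r : Setoid (Option (Fin n)) :=
    { r := fun x y => (x, y) ∈ S
      iseqv :=
        { refl := fun x => by rw [hmem, bond_self, one_mul]
          symm := fun {x y} h => by rwa [hmem, bond_comm, ← hmem]
          trans := fun {x y z} h h' => by
            rw [hmem] at h h' ⊢
            have e := bond_mul_bond x y z
            have e' := congrArg (· * commAeval K bond bond_bond (eigenPoly K S)) e
            rw [mul_assoc, h', h, (bond_bond _ _).eq, mul_assoc, h] at e'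
            exact e'.symm } }
  obtain ⟨c, hc1, hcd, hcr⟩ := exists_colouring hd r
  refine Eq.trans ?_ (hq c hc1 hcd)
  congr 2
  funext p
  have h := hcr p.1 p.2
  unfold delta
  by_cases hp : p ∈ S
  · rw [if_pos hp, if_pos (h.2 hp)]
  · rw [if_neg hp, if_neg fun e => hp (h.1 e)]

theorem T_tiePoly (i : Fin (n - 1)) (q : MvPolynomial (Option (Fin n) × Option (Fin n)) K) :
    SemiconjBy (T i) (tiePoly q)
      (tiePoly (MvPolynomial.rename (fun p => (p.1.map (s i), p.2.map (s i))) q)) := by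
  induction q using MvPolynomial.induction_on with
  | C a =>
    rw [MvPolynomial.rename_C, ← MvPolynomial.algebraMap_eq, AlgHom.commutes]
    exact (Algebra.commutes a _).symm
  | add p q hp hq => rw [map_add, map_add, map_add]; exact hp.add_right hq
  | mul_X q p hq =>
    rw [map_mul, map_mul, map_mul, MvPolynomial.rename_X, tiePoly_X, tiePoly_X]
    exact hq.mul_right (T_bond i p.1 p.2)

theorem B_tiePoly (q : MvPolynomial (Option (Fin n) × Option (Fin n)) K) :
    Commute (B n) (tiePoly q) := by
  induction q using MvPolynomial.induction_on with
  | C a =>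
    rw [← MvPolynomial.algebraMap_eq, AlgHom.commutes]
    exact (Algebra.commutes a _).symm
  | add p q hp hq => rw [map_add]; exact hp.add_right hq
  | mul_X q p hq =>
    rw [map_mul, tiePoly_X]
    exact hq.mul_right (B_bond p)

theorem E_eq_tiePoly (i : Fin (n - 1)) :
    E i = tiePoly (MvPolynomial.X (some (lo i), some (hi i))) := by
  rw [tiePoly_X, bond, tie_lo_hi]

theorem F_eq_tiePoly (j : Fin n) : F j = tiePoly (MvPolynomial.X (none, some j)) := by
  rw [tiePoly_X, bond]

/-- The linear combination of the standard elements with polynomials in the ties as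
coefficients. -/
def standard : (SWord n →₀ MvPolynomial (Option (Fin n) × Option (Fin n)) K) →ₗ[K] BT n :=
  Finsupp.lsum K fun a => (LinearMap.mulRight K (Tw a)).comp tiePoly.toLinearMap

theorem standard_single (a : SWord n) (q : MvPolynomial (Option (Fin n) × Option (Fin n)) K) :
    standard (Finsupp.single a q) = tiePoly q * Tw a := by
  simp [standard]

theorem tiePoly_mul_Tw_mem (a : SWord n)
    (q : MvPolynomial (Option (Fin n) × Option (Fin n)) K) :
    tiePoly q * Tw a ∈ LinearMap.range (standard (n := n)) :=
  ⟨_, standard_single a q⟩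

theorem gen_mul_mem (x : BTGen n) (a : SWord n)
    (q : MvPolynomial (Option (Fin n) × Option (Fin n)) K) :
    mk n (FreeAlgebra.ι K x) * (tiePoly q * Tw a) ∈ LinearMap.range (standard (n := n)) := by
  cases x with
  | B =>
    change B n * _ ∈ _
    rw [← mul_assoc, (B_tiePoly q).eq, mul_assoc]
    rcases B_mul_Tw a with h | h <;> rw [h]
    · exact tiePoly_mul_Tw_mem _ _
    · rw [mul_add, mul_smul_comm, ← mul_assoc, F_eq_tiePoly, ← map_mul]
      exact add_mem (tiePoly_mul_Tw_mem _ _) (Submodule.smul_mem _ _ (tiePoly_mul_Tw_mem _ _))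
  | T i =>
    change T i * _ ∈ _
    rw [← mul_assoc, (T_tiePoly i q).eq, mul_assoc]
    rcases T_mul_Tw i a with h | h <;> rw [h]
    · exact tiePoly_mul_Tw_mem _ _
    · rw [mul_add, mul_smul_comm, ← mul_assoc, E_eq_tiePoly, ← map_mul]
      exact add_mem (tiePoly_mul_Tw_mem _ _) (Submodule.smul_mem _ _ (tiePoly_mul_Tw_mem _ _))
  | F j =>
    change F j * _ ∈ _
    rw [← mul_assoc, F_eq_tiePoly, ← map_mul]
    exact tiePoly_mul_Tw_mem _ _
  | E i =>
    change E i * _ ∈ _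
    rw [← mul_assoc, E_eq_tiePoly, ← map_mul]
    exact tiePoly_mul_Tw_mem _ _

/-- The span of the standard products is a left ideal; since it contains `1`, it is the whole
algebra. -/
theorem mul_mem_range_standard (x : BTFree.Alg n) {y : BT n}
    (hy : y ∈ LinearMap.range (standard (n := n))) :
    mk n x * y ∈ LinearMap.range (standard (n := n)) := by
  induction x using FreeAlgebra.induction generalizing y with
  | grade0 r =>
    rw [AlgHom.commutes, ← Algebra.smul_def]
    exact Submodule.smul_mem _ _ hy
  | grade1 x =>
    obtain ⟨f, rfl⟩ := hy
    induction f using Finsupp.induction_linear with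
    | zero => rw [map_zero, mul_zero]; exact zero_mem _
    | add f g hf hg => rw [map_add, mul_add]; exact add_mem hf hg
    | single a q => rw [standard_single]; exact gen_mul_mem x a q
  | mul a b ha hb => rw [map_mul, mul_assoc]; exact ha (hb hy)
  | add a b ha hb => rw [map_add, add_mul]; exact add_mem (ha hy) (hb hy)

theorem standard_surjective : Function.Surjective (standard (n := n)) := fun x => by
  obtain ⟨x, rfl⟩ := RingQuot.mkAlgHom_surjective K (BTRel n) x
  have h1 := tiePoly_mul_Tw_mem (SWord.id n) 1
  rw [map_one, Tw_id, mul_one] at h1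
  have h := mul_mem_range_standard x h1
  rwa [mul_one] at h

end Spanning

/-! ### The action of ties and standard elements on coloured words -/

section Action

variable {n d : ℕ} [NeZero n] {χ : ℕ → K} {ρ : BT n →ₐ[K] Module.End K (SWord n →₀ K)}

/-- Ties and averages of the `opT` are transported in the same way by the action of the `T_k`, so it
suffices to compare them at one pair of adjacent positions, where the action is given. -/
theorem action_tie (hd : (d : K) ≠ 0) (hχ : ∀ m, χ m ^ d = 1) (hρ : IsColouredAction d χ ρ)
    (a b : Fin n) : ρ (tie a b) = avg K d (opT χ a) (opT χ b) := by
  by_cases hab : a = b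
  · rw [hab, tie_self, map_one, avg_self hd (opT_pow hχ b)]
  have hn : 0 < n - 1 := by
    have h1 := a.2
    have h2 := b.2
    have h3 := Fin.val_ne_of_ne hab
    omega
  obtain ⟨σ, rfl, rfl⟩ := exists_perm (lo_ne_hi ⟨0, hn⟩) hab
  have hσ : σ ∈ Submonoid.closure (Set.range (s (n := n))) := by
    rw [closure_s]; exact Submonoid.mem_top σ
  have key : ∀ x y, ρ (tie x y) = avg K d (opT χ x) (opT χ y) →
      ρ (tie (σ x) (σ y)) = avg K d (opT χ (σ x)) (opT χ (σ y)) := by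
    clear hab
    induction hσ using Submonoid.closure_induction with
    | mem σ h =>
      obtain ⟨k, rfl⟩ := h
      intro x y hxy
      have h1 := congrArg ρ (T_tie k x y).eq
      have h2 : ∀ x, SemiconjBy (ρ (T k)) (opT χ x) (opT χ (s k x)) := fun x => by
        have := opT_opG (χ := χ) (q := u - u⁻¹) (s k x) k
        rw [s_s] at this
        rw [hρ.T]
        exact this.symm
      rw [map_mul, map_mul, hxy] at h1
      exact semiconjBy_unique (τ := Units.map ρ.toMonoidHom (Tu k)) h1
        (semiconjBy_avg (h2 x) (h2 y))
    | one => exact fun _ _ h => h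
    | mul σ σ' _ _ h h' => exact fun x y hxy => h _ _ (h' _ _ hxy)
  refine key _ _ ?_
  rw [tie_lo_hi, hρ.E]

theorem delta_comm {k : Type*} [Field k] (x y : k) : delta x y = delta y x := by
  unfold delta
  by_cases h : x = y
  · rw [h]
  · rw [if_neg h, if_neg (Ne.symm h)]

/-- The colours of `0, 1, …, n` in a signed permutation. -/
def colour (χ : ℕ → K) (a : SWord n) : Option (Fin n) → K
  | none => 1
  | some j => χ (a j).natAbs

theorem action_bond_vec (hd : (d : K) ≠ 0) (hχ : ∀ m, χ m ^ d = 1) (hρ : IsColouredAction d χ ρ)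
    (p : Option (Fin n) × Option (Fin n)) (a : SWord n) :
    ρ (bond p) (vec K a) = delta (colour χ a p.1) (colour χ a p.2) • vec K a := by
  rcases p with ⟨_ | i, _ | j⟩ <;> simp only [bond, colour]
  · rw [map_one, Module.End.one_apply, delta, if_pos rfl, one_smul]
  · rw [hρ.F, avg_opT_one_vec hd hχ]
    rw [delta_comm]
  · rw [hρ.F, avg_opT_one_vec hd hχ]
  · rw [action_tie hd hχ hρ, avg_opT_vec hd hχ]

theorem action_tiePoly_vec (hd : (d : K) ≠ 0) (hχ : ∀ m, χ m ^ d = 1)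
    (hρ : IsColouredAction d χ ρ) (q : MvPolynomial (Option (Fin n) × Option (Fin n)) K)
    (a : SWord n) : ρ (tiePoly q) (vec K a) =
      MvPolynomial.eval (fun p => delta (colour χ a p.1) (colour χ a p.2)) q • vec K a := by
  induction q using MvPolynomial.induction_on with
  | C r =>
    rw [MvPolynomial.eval_C, ← MvPolynomial.algebraMap_eq, AlgHom.commutes, AlgHom.commutes,
      Module.algebraMap_end_apply]
  | add p q hp hq => rw [map_add, map_add, LinearMap.add_apply, hp, hq, map_add, add_smul]
  | mul_X q p hq =>
    rw [map_mul, map_mul, Module.End.mul_apply, tiePoly_X, action_bond_vec hd hχ hρ, map_smul, hq,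
      smul_smul, map_mul, MvPolynomial.eval_X, mul_comm]

/-- Each `Tw b` sends the identity word to `b`, and its polynomial coefficient acts there by a
scalar, so the coordinate at `a` isolates the coefficient of `Tw a`. -/
theorem action_standard (hd : (d : K) ≠ 0) (hχ : ∀ m, χ m ^ d = 1) (hρ : IsColouredAction d χ ρ)
    (f : SWord n →₀ MvPolynomial (Option (Fin n) × Option (Fin n)) K) (a : SWord n) :
    ρ (standard f) (vec K (SWord.id n)) a =
      MvPolynomial.eval (fun p => delta (colour χ a p.1) (colour χ a p.2)) (f a) := by
  classical
  induction f using Finsupp.induction_linear with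
  | zero => simp
  | add f g hf hg =>
    rw [map_add, map_add, LinearMap.add_apply, Finsupp.add_apply, hf, hg, Finsupp.add_apply,
      map_add]
  | single b q =>
    rw [standard_single, map_mul, Module.End.mul_apply, action_Tw hρ,
      action_tiePoly_vec hd hχ hρ, vec, Finsupp.smul_single, smul_eq_mul, mul_one,
      Finsupp.single_apply, Finsupp.single_apply]
    split_ifs with h
    · rw [h]
    · rw [map_zero]

end Action

theorem exists_colour_eq {n d : ℕ} (a : SWord n) (c : Option (Fin n) → K) (h₁ : c none = 1)
    (hc : ∀ x, c x ^ d = 1) : ∃ χ : ℕ → K, (∀ m, χ m ^ d = 1) ∧ colour χ a = c := by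
  classical
  -- The letters have distinct absolute values, so their colours can be prescribed freely; the
  -- default colour `1` keeps the condition on `d`-th powers for all other numbers.
  refine ⟨Function.extend (fun j => (a j).natAbs) (fun j => c (some j)) 1, fun m => ?_,
    funext fun x => ?_⟩
  · by_cases h : ∃ j, (a j).natAbs = m
    · obtain ⟨j, rfl⟩ := h
      rw [a.natAbs_injective.extend_apply (fun j => c (some j)), hc]
    · rw [Function.extend_apply' _ _ _ h, Pi.one_apply, one_pow]
  · cases x with
    | none => exact h₁.symm
    | some j => exact a.natAbs_injective.extend_apply (fun j => c (some j)) _ j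

end BT

/-! ### Injectivity -/

theorem IsNatural.injective {n d : ℕ} [NeZero n] (hd : n + 1 ≤ d) (hd0 : (d : K) ≠ 0)
    {φ : BT n →ₐ[K] YB d n} (hφ : IsNatural φ) : Function.Injective φ := by
  refine injective_of_map_eq_zero (k := K) (A := BT n) (A' := YB d n) φ fun x hx => ?_
  obtain ⟨f, rfl⟩ := BT.standard_surjective x
  -- The colouring of the letters is chosen separately for each word `a`, so that the positions of
  -- `a` receive the prescribed colours `c`.
  have key : ∀ a, BT.tiePoly (f a) = 0 := fun a => BT.tiePoly_eq_zero hd fun c h₁ hc => by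
    obtain ⟨χ, hχ, rfl⟩ := BT.exists_colour_eq a c h₁ hc
    rw [← BT.action_standard hd0 hχ (isColouredAction_comp hd0 hχ hφ), AlgHom.comp_apply, hx,
      map_zero, LinearMap.zero_apply, Finsupp.zero_apply]
  rw [BT.standard, Finsupp.lsum_apply]
  refine Finset.sum_eq_zero fun a _ => ?_
  simp [key a]

end

end BraidsTiesB

theorem mainTheorem6 (n d : ℕ) [NeZero n] (hd : n + 1 ≤ d) :
    (∃! φ : BraidsTiesB.BT n →ₐ[BraidsTiesB.K] BraidsTiesB.YB d n, BraidsTiesB.IsNatural φ) ∧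
      ∀ φ : BraidsTiesB.BT n →ₐ[BraidsTiesB.K] BraidsTiesB.YB d n,
        BraidsTiesB.IsNatural φ → Function.Injective φ := by
  have hd0 : (d : BraidsTiesB.K) ≠ 0 := Nat.cast_ne_zero.2 (by omega)
  exact ⟨⟨BraidsTiesB.natural hd0, BraidsTiesB.natural_isNatural hd0,
    fun _ h => h.unique (BraidsTiesB.natural_isNatural hd0)⟩, fun _ h => h.injective hd hd0⟩
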